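/- **Proposition 2.1.** Manifolds are smooth, finite-dimensional, Hausdorff, second countable and without boundary, and all tensor fields are smooth. Let $(M,\Omega)$ be a symplectic manifold. *Conventions.* A bilinear form $B$ on $TM$ is identified with the bundle map $TM\to T^*M$, $X\mapsto B(X,\cdot)$; for an endomorphism $J$ of $TM$, $J^*\xi=\xi\circ J$. On $TM\oplus T^*M$ put $\langle X+\xi,Y+\eta\rangle=\tfrac12(\xi(Y)+\eta(X))$. An *almost generalized complex structure* is an endomorphism $\mathcal J$ of $TM\oplus T^*M$ that is orthogonal for $\langle\cdot,\cdot\rangle$ and satisfies $\mathcal J^2=-1$; it is *integrable* if the sections of its $+i$-eigenbundle in $(TM\oplus T^*M)\otimes\mathbb C$ are closed under the (complex bilinear extension of the) Courant bracket $$[X+\xi,Y+\eta]=[X,Y]+\mathcal L_X\eta-\mathcal L_Y\xi-\tfrac12 d(\eta(X)-\xi(Y)).$$ An *almost generalized Kähler structure* is a pair $(\mathcal J_1,\mathcal J_2)$ of commuting almost generalized complex structures such that $\mathcal G=-\mathcal J_1\mathcal J_2$ is a positive definite metric, i.e. $\langle\mathcal G u,v\rangle$ is symmetric and positive definite; it is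 *integrable* if $\mathcal J_1$ and $\mathcal J_2$ are. An almost complex structure $J$ on $M$ is *tamed* by $\Omega$ if $\Omega(JX,X)>0$ for every tangent vector $X\neq0$, and it is *integrable* if its Nijenhuis tensor $N(X,Y)=[X,Y]-[JX,JY]+J[JX,Y]+J[X,JY]$ vanishes. Let $$\mathcal J_\Omega=\begin{pmatrix}0&\Omega^{-1}\\-\Omega&0\end{pmatrix}.$$ A quadruple $(g,b,J_+,J_-)$, where $g$ is a Riemannian metric, $b$ a 2-form and $J_\pm$ are almost complex structures that are orthogonal for $g$, *induces* the pair $(\mathcal J_1,\mathcal J_2)$ given, with $\omega_\pm=gJ_\pm:TM\to T^*M$, by $$\mathcal J_1=\tfrac12\begin{pmatrix}1&0\\-b&1\end{pmatrix}\begin{pmatrix}J_+-J_-&-(\omega_-^{-1}+\omega_+^{-1})\\ \omega_-+\omega_+&-(J_+^*-J_-^*)\end{pmatrix}\begin{pmatrix}1&0\\b&1\end{pmatrix},$$ $$\mathcal J_2=\tfrac12\begin{pmatrix}1&0\\-b&1\end{pmatrix}\begin{pmatrix}J_-+J_+&\omega_-^{-1}-\omega_+^{-1}\\-(\omega_--\omega_+)&-(J_-^*+J_+^*)\end{pmatrix}\begin{pmatrix}1&0\\b&1\end{pmatrix}.$$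 *Statement.* There is a bijection $J\mapsto\mathcal J(J)$ from the set of almost complex structures $J$ on $M$ tamed by $\Omega$ onto the set of those $\mathcal J$ for which $(\mathcal J_\Omega,\mathcal J)$ is an almost generalized Kähler structure, such that for every such $J$: 1. there is exactly one quadruple $(g,b,J_+,J_-)$ as above that induces $(\mathcal J_\Omega,\mathcal J(J))$, namely $$J_+=J,\qquad J_-=-\Omega^{-1}J^*\Omega,\qquad g=\tfrac12\Omega(J_++J_-),\qquad b=-\tfrac12\Omega(J_+-J_-);$$ 2. $(\mathcal J_\Omega,\mathcal J(J))$ is integrable if and only if both almost complex structures $J$ and $-\Omega^{-1}J^*\Omega$ are integrable. Moreover, the position of $\mathcal J_\Omega$ in the pair is immaterial: for every $\mathcal J$, $(\mathcal J,\mathcal J_\Omega)$ is an almost generalized Kähler structure if and only if $(\mathcal J_\Omega,\mathcal J)$ is, and the one pair is integrable if and only if the other is. -/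

import Mathlib

open scoped Manifold ContDiff Bundle

noncomputable section

namespace GenKahler

section Fields

variable {E : Type*} [NormedAddCommGroup E] [NormedSpace ℝ E]
  {M : Type*} [TopologicalSpace M] [ChartedSpace E M]

/-! ### Bundles and smooth tensor fields -/

/-- The tangent space `T_x M`. -/
abbrev TS (E : Type*) [NormedAddCommGroup E] [NormedSpace ℝ E]
    {M : Type*} [TopologicalSpace M] [ChartedSpace E M] (x : M) : Type _ :=
  TangentSpace 𝓘(ℝ, E) x

/-- The cotangent space `T*_x M`. -/
abbrev CoT (E : Type*) [NormedAddCommGroup E] [NormedSpace ℝ E]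
    {M : Type*} [TopologicalSpace M] [ChartedSpace E M] (x : M) : Type _ :=
  TangentSpace 𝓘(ℝ, E) x →L[ℝ] ℝ

/-- The fibre `T_x M ⊕ T*_x M` of the generalized tangent bundle. -/
abbrev GenT (E : Type*) [NormedAddCommGroup E] [NormedSpace ℝ E]
    {M : Type*} [TopologicalSpace M] [ChartedSpace E M] (x : M) : Type _ :=
  TS E x × CoT E x

section Smooth

variable [IsManifold 𝓘(ℝ, E) ∞ M]

/-- `X` is a smooth vector field. -/
def SmoothVF (X : ∀ x : M, TS E x) : Prop :=
  ContMDiff 𝓘(ℝ, E) (𝓘(ℝ, E).prod 𝓘(ℝ, E)) ∞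
    (fun x ↦ Bundle.TotalSpace.mk' E (E := fun x : M ↦ TS E x) x (X x))

/-- `ξ` is a smooth 1-form. -/
def SmoothCo (ξ : ∀ x : M, CoT E x) : Prop :=
  ContMDiff 𝓘(ℝ, E) (𝓘(ℝ, E).prod 𝓘(ℝ, E →L[ℝ] ℝ)) ∞
    (fun x ↦ Bundle.TotalSpace.mk' (E →L[ℝ] ℝ) (E := fun x : M ↦ CoT E x) x (ξ x))

/-- `J` is a smooth bundle map `TM → TM`. -/
def SmoothTT (J : ∀ x : M, TS E x →L[ℝ] TS E x) : Prop :=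
  ContMDiff 𝓘(ℝ, E) (𝓘(ℝ, E).prod 𝓘(ℝ, E →L[ℝ] E)) ∞
    (fun x ↦ Bundle.TotalSpace.mk' (E →L[ℝ] E)
      (E := fun x : M ↦ TS E x →L[ℝ] TS E x) x (J x))

/-- `B` is a smooth bundle map `TM → T*M`, equivalently a smooth bilinear form `B(X, Y)` on `TM`;
the two are identified by `B X = B(X, ·)`. -/
def SmoothTC (B : ∀ x : M, TS E x →L[ℝ] CoT E x) : Prop :=
  ContMDiff 𝓘(ℝ, E) (𝓘(ℝ, E).prod 𝓘(ℝ, E →L[ℝ] (E →L[ℝ] ℝ))) ∞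
    (fun x ↦ Bundle.TotalSpace.mk' (E →L[ℝ] (E →L[ℝ] ℝ))
      (E := fun x : M ↦ TS E x →L[ℝ] CoT E x) x (B x))

/-- `β` is a smooth bundle map `T*M → TM`. -/
def SmoothCT (β : ∀ x : M, CoT E x →L[ℝ] TS E x) : Prop :=
  ContMDiff 𝓘(ℝ, E) (𝓘(ℝ, E).prod 𝓘(ℝ, (E →L[ℝ] ℝ) →L[ℝ] E)) ∞
    (fun x ↦ Bundle.TotalSpace.mk' ((E →L[ℝ] ℝ) →L[ℝ] E)
      (E := fun x : M ↦ CoT E x →L[ℝ] TS E x) x (β x))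

/-- `D` is a smooth bundle map `T*M → T*M`. -/
def SmoothCC (D : ∀ x : M, CoT E x →L[ℝ] CoT E x) : Prop :=
  ContMDiff 𝓘(ℝ, E) (𝓘(ℝ, E).prod 𝓘(ℝ, (E →L[ℝ] ℝ) →L[ℝ] (E →L[ℝ] ℝ))) ∞
    (fun x ↦ Bundle.TotalSpace.mk' ((E →L[ℝ] ℝ) →L[ℝ] (E →L[ℝ] ℝ))
      (E := fun x : M ↦ CoT E x →L[ℝ] CoT E x) x (D x))

/-- `u` is a smooth section of `TM ⊕ T*M`. -/
def SmoothGen (u : ∀ x : M, GenT E x) : Prop :=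
  SmoothVF (fun x ↦ (u x).1) ∧ SmoothCo (fun x ↦ (u x).2)

/-- `𝒥` is a smooth endomorphism of `TM ⊕ T*M`: its four blocks are smooth bundle maps. -/
def SmoothGenEnd (𝒥 : ∀ x : M, GenT E x →L[ℝ] GenT E x) : Prop :=
  SmoothTT (fun x ↦ (ContinuousLinearMap.fst ℝ (TS E x) (CoT E x)).comp
    ((𝒥 x).comp (ContinuousLinearMap.inl ℝ (TS E x) (CoT E x)))) ∧
  SmoothCT (fun x ↦ (ContinuousLinearMap.fst ℝ (TS E x) (CoT E x)).comp
    ((𝒥 x).comp (ContinuousLinearMap.inr ℝ (TS E x) (CoT E x)))) ∧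
  SmoothTC (fun x ↦ (ContinuousLinearMap.snd ℝ (TS E x) (CoT E x)).comp
    ((𝒥 x).comp (ContinuousLinearMap.inl ℝ (TS E x) (CoT E x)))) ∧
  SmoothCC (fun x ↦ (ContinuousLinearMap.snd ℝ (TS E x) (CoT E x)).comp
    ((𝒥 x).comp (ContinuousLinearMap.inr ℝ (TS E x) (CoT E x))))

end Smooth

/-! ### Exterior derivatives, computed at `x` in the preferred chart around `x` -/

/-- The 1-form `ξ` written in the preferred chart around `x`. -/
def chartCo (ξ : ∀ x : M, CoT E x) (x : M) (y : E) : E →L[ℝ] ℝ :=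
  (ξ ((extChartAt 𝓘(ℝ, E) x).symm y)).comp
    (mfderiv 𝓘(ℝ, E) 𝓘(ℝ, E) (extChartAt 𝓘(ℝ, E) x).symm y)

/-- The contraction `ι_v dξ = dξ(v, ·)` at `x` of the exterior derivative of a 1-form `ξ` with
a tangent vector `v`; here `dξ(v, w) = (D_v ξ)(w) - (D_w ξ)(v)` in the chart. -/
def dCo (ξ : ∀ x : M, CoT E x) (x : M) (v : TS E x) : CoT E x :=
  ((fderiv ℝ (chartCo ξ x) (extChartAt 𝓘(ℝ, E) x x) -
      (fderiv ℝ (chartCo ξ x) (extChartAt 𝓘(ℝ, E) x x)).flip)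
    (mfderiv 𝓘(ℝ, E) 𝓘(ℝ, E) (extChartAt 𝓘(ℝ, E) x) x v)).comp
    (mfderiv 𝓘(ℝ, E) 𝓘(ℝ, E) (extChartAt 𝓘(ℝ, E) x) x)

/-- The bilinear form `B` written in the preferred chart around `x`. -/
def chartBil (B : ∀ x : M, TS E x →L[ℝ] CoT E x) (x : M) (y : E) : E →L[ℝ] E →L[ℝ] ℝ :=
  (ContinuousLinearMap.precomp ℝ
      (mfderiv 𝓘(ℝ, E) 𝓘(ℝ, E) (extChartAt 𝓘(ℝ, E) x).symm y)).comp
    ((B ((extChartAt 𝓘(ℝ, E) x).symm y)).comp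
      (mfderiv 𝓘(ℝ, E) 𝓘(ℝ, E) (extChartAt 𝓘(ℝ, E) x).symm y))

/-- `dB = 0` for a 2-form `B`, where
`dB(u, v, w) = (D_u B)(v, w) - (D_v B)(u, w) + (D_w B)(u, v)` in the chart. -/
def ClosedBil (B : ∀ x : M, TS E x →L[ℝ] CoT E x) : Prop :=
  ∀ (x : M) (u v w : E),
    fderiv ℝ (chartBil B x) (extChartAt 𝓘(ℝ, E) x x) u v w
      - fderiv ℝ (chartBil B x) (extChartAt 𝓘(ℝ, E) x x) v u w
      + fderiv ℝ (chartBil B x) (extChartAt 𝓘(ℝ, E) x x) w u v = 0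

/-! ### Symplectic forms and almost complex structures -/

/-- `Ω` is a symplectic form: a smooth closed non-degenerate 2-form. -/
structure IsSymplectic [IsManifold 𝓘(ℝ, E) ∞ M] (Ω : ∀ x : M, TS E x →L[ℝ] CoT E x) : Prop where
  smooth : SmoothTC Ω
  alt : ∀ (x : M) (v : TS E x), Ω x v v = 0
  nondeg : ∀ (x : M) (v : TS E x), (∀ w : TS E x, Ω x v w = 0) → v = 0
  closed : ClosedBil Ω

/-- `J` is a (smooth) almost complex structure. -/
structure IsAlmostComplex [IsManifold 𝓘(ℝ, E) ∞ M]
    (J : ∀ x : M, TS E x →L[ℝ] TS E x) : Prop where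
  smooth : SmoothTT J
  sq : ∀ (x : M) (v : TS E x), J x (J x v) = -v

/-- `Ω` tames `J`. -/
def Tames (Ω : ∀ x : M, TS E x →L[ℝ] CoT E x) (J : ∀ x : M, TS E x →L[ℝ] TS E x) : Prop :=
  ∀ (x : M) (v : TS E x), v ≠ 0 → 0 < Ω x (J x v) v

/-- The Nijenhuis tensor `N(X, Y) = [X, Y] - [JX, JY] + J[JX, Y] + J[X, JY]`. -/
def nijenhuis (J : ∀ x : M, TS E x →L[ℝ] TS E x) (X Y : ∀ x : M, TS E x) (x : M) : TS E x :=
  VectorField.mlieBracket 𝓘(ℝ, E) X Y x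
    - VectorField.mlieBracket 𝓘(ℝ, E) (fun y ↦ J y (X y)) (fun y ↦ J y (Y y)) x
    + J x (VectorField.mlieBracket 𝓘(ℝ, E) (fun y ↦ J y (X y)) Y x)
    + J x (VectorField.mlieBracket 𝓘(ℝ, E) X (fun y ↦ J y (Y y)) x)

/-- Integrability of an almost complex structure: its Nijenhuis tensor vanishes. -/
def IntegrableAC [IsManifold 𝓘(ℝ, E) ∞ M] (J : ∀ x : M, TS E x →L[ℝ] TS E x) : Prop :=
  ∀ X Y : ∀ x : M, TS E x, SmoothVF X → SmoothVF Y → ∀ x : M, nijenhuis J X Y x = 0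

/-- The dual endomorphism `J* : T*M → T*M`, `J* ξ = ξ ∘ J`. -/
def dualEnd (J : ∀ x : M, TS E x →L[ℝ] TS E x) (x : M) : CoT E x →L[ℝ] CoT E x :=
  ContinuousLinearMap.precomp ℝ (J x)

/-- `-Ω⁻¹ J* Ω`. -/
def minusConj (Ω : ∀ x : M, TS E x →L[ℝ] CoT E x) (J : ∀ x : M, TS E x →L[ℝ] TS E x) (x : M) :
    TS E x →L[ℝ] TS E x :=
  -((Ω x).inverse.comp ((dualEnd J x).comp (Ω x)))

/-! ### Generalized complex and generalized Kähler structures -/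

/-- The natural inner product `⟨X + ξ, Y + η⟩ = ½ (ξ(Y) + η(X))` on `TM ⊕ T*M`. -/
def pairing {x : M} (u v : GenT E x) : ℝ := (1 / 2 : ℝ) * (u.2 v.1 + v.2 u.1)

/-- The Courant bracket
`[X + ξ, Y + η] = [X, Y] + L_X η - L_Y ξ - ½ d(η(X) - ξ(Y))`
of real sections of `TM ⊕ T*M`; by Cartan's formula its 1-form part is
`ι_X dη - ι_Y dξ + ½ d(η(X) - ξ(Y))`. -/
def courant (u v : ∀ x : M, GenT E x) (x : M) : GenT E x :=
  (VectorField.mlieBracket 𝓘(ℝ, E) (fun y ↦ (u y).1) (fun y ↦ (v y).1) x,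
    dCo (fun y ↦ (v y).2) x (u x).1 - dCo (fun y ↦ (u y).2) x (v x).1
      + (1 / 2 : ℝ) • mvfderiv 𝓘(ℝ, E) (fun y ↦ (v y).2 (u y).1 - (u y).2 (v y).1) x)

/-- `a + i b ∈ (TM ⊕ T*M) ⊗ ℂ` lies in the `+i`-eigenspace of `𝒥`, i.e.
`𝒥 a + i 𝒥 b = i (a + i b)`. -/
def MemEigen (𝒥 : ∀ x : M, GenT E x →L[ℝ] GenT E x) (x : M) (a b : GenT E x) : Prop :=
  𝒥 x a = -b ∧ 𝒥 x b = a

/-- `𝒥` is an almost generalized complex structure. -/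
structure IsAlmostGC [IsManifold 𝓘(ℝ, E) ∞ M]
    (𝒥 : ∀ x : M, GenT E x →L[ℝ] GenT E x) : Prop where
  smooth : SmoothGenEnd 𝒥
  sq : ∀ (x : M) (u : GenT E x), 𝒥 x (𝒥 x u) = -u
  orth : ∀ (x : M) (u v : GenT E x), pairing (𝒥 x u) (𝒥 x v) = pairing u v

/-- Integrability of `𝒥`: the smooth complex sections of its `+i`-eigenbundle are closed under the
complex bilinear extension
`[a + i b, c + i d] = [a, c] - [b, d] + i ([a, d] + [b, c])` of the Courant bracket. -/
def IntegrableGC [IsManifold 𝓘(ℝ, E) ∞ M] (𝒥 : ∀ x : M, GenT E x →L[ℝ] GenT E x) : Prop :=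
  ∀ a b c d : ∀ x : M, GenT E x, SmoothGen a → SmoothGen b → SmoothGen c → SmoothGen d →
    (∀ x, MemEigen 𝒥 x (a x) (b x)) → (∀ x, MemEigen 𝒥 x (c x) (d x)) →
    ∀ x, MemEigen 𝒥 x (courant a c x - courant b d x) (courant a d x + courant b c x)

/-- `(𝒥₁, 𝒥₂)` is an almost generalized Kähler structure: a commuting pair of almost generalized
complex structures such that `𝒢 = -𝒥₁ 𝒥₂` is a positive definite metric on `TM ⊕ T*M`. -/
structure IsAlmostGK [IsManifold 𝓘(ℝ, E) ∞ M]
    (𝒥₁ 𝒥₂ : ∀ x : M, GenT E x →L[ℝ] GenT E x) : Prop where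
  fst : IsAlmostGC 𝒥₁
  snd : IsAlmostGC 𝒥₂
  comm : ∀ (x : M) (u : GenT E x), 𝒥₁ x (𝒥₂ x u) = 𝒥₂ x (𝒥₁ x u)
  symm : ∀ (x : M) (u v : GenT E x), pairing (-𝒥₁ x (𝒥₂ x u)) v = pairing (-𝒥₁ x (𝒥₂ x v)) u
  pos : ∀ (x : M) (u : GenT E x), u ≠ 0 → 0 < pairing (-𝒥₁ x (𝒥₂ x u)) u

/-- Integrability of an almost generalized Kähler structure. -/
def IntegrableGK [IsManifold 𝓘(ℝ, E) ∞ M]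
    (𝒥₁ 𝒥₂ : ∀ x : M, GenT E x →L[ℝ] GenT E x) : Prop :=
  IntegrableGC 𝒥₁ ∧ IntegrableGC 𝒥₂

/-- The endomorphism of `T_x M ⊕ T*_x M` with block matrix `(A, β; B, D)`. -/
def blocks {x : M} (A : TS E x →L[ℝ] TS E x) (β : CoT E x →L[ℝ] TS E x)
    (B : TS E x →L[ℝ] CoT E x) (D : CoT E x →L[ℝ] CoT E x) : GenT E x →L[ℝ] GenT E x :=
  (A.comp (ContinuousLinearMap.fst ℝ (TS E x) (CoT E x))
      + β.comp (ContinuousLinearMap.snd ℝ (TS E x) (CoT E x))).prod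
    (B.comp (ContinuousLinearMap.fst ℝ (TS E x) (CoT E x))
      + D.comp (ContinuousLinearMap.snd ℝ (TS E x) (CoT E x)))

/-- `𝒥_Ω = (0, Ω⁻¹; -Ω, 0)`. -/
def genOmega (Ω : ∀ x : M, TS E x →L[ℝ] CoT E x) (x : M) : GenT E x →L[ℝ] GenT E x :=
  blocks 0 (Ω x).inverse (-Ω x) 0

end Fields

/-! ### Almost bihermitian structures with a 2-form -/

/-- A quadruple of tensor fields `(g, b, J₊, J₋)`. -/
@[ext]
structure Quadruple (E : Type*) [NormedAddCommGroup E] [NormedSpace ℝ E]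
    (M : Type*) [TopologicalSpace M] [ChartedSpace E M] where
  g : ∀ x : M, TS E x →L[ℝ] CoT E x
  b : ∀ x : M, TS E x →L[ℝ] CoT E x
  Jp : ∀ x : M, TS E x →L[ℝ] TS E x
  Jm : ∀ x : M, TS E x →L[ℝ] TS E x

section Bihermitian

variable {E : Type*} [NormedAddCommGroup E] [NormedSpace ℝ E]
  {M : Type*} [TopologicalSpace M] [ChartedSpace E M]

/-- `g` is a Riemannian metric, `b` is a 2-form, and `J₊`, `J₋` are almost complex structures
compatible with `g`. -/
structure Quadruple.IsAlmostBihermitian [IsManifold 𝓘(ℝ, E) ∞ M] (q : Quadruple E M) : Prop where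
  g_smooth : SmoothTC q.g
  g_symm : ∀ (x : M) (v w : TS E x), q.g x v w = q.g x w v
  g_pos : ∀ (x : M) (v : TS E x), v ≠ 0 → 0 < q.g x v v
  b_smooth : SmoothTC q.b
  b_alt : ∀ (x : M) (v : TS E x), q.b x v v = 0
  Jp_ac : IsAlmostComplex q.Jp
  Jm_ac : IsAlmostComplex q.Jm
  Jp_herm : ∀ (x : M) (v w : TS E x), q.g x (q.Jp x v) (q.Jp x w) = q.g x v w
  Jm_herm : ∀ (x : M) (v w : TS E x), q.g x (q.Jm x v) (q.Jm x w) = q.g x v w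

/-- `ω₊ = g J₊ : TM → T*M`; as bilinear forms, `(ω₊ X)(Y) = g(Y, J₊ X)`. -/
def Quadruple.ωp (q : Quadruple E M) (x : M) : TS E x →L[ℝ] CoT E x := (q.g x).comp (q.Jp x)

/-- `ω₋ = g J₋ : TM → T*M`. -/
def Quadruple.ωm (q : Quadruple E M) (x : M) : TS E x →L[ℝ] CoT E x := (q.g x).comp (q.Jm x)

/-- The shear `(1, 0; B, 1)`. -/
def shear {x : M} (B : TS E x →L[ℝ] CoT E x) : GenT E x →L[ℝ] GenT E x :=
  blocks (ContinuousLinearMap.id ℝ (TS E x)) 0 B (ContinuousLinearMap.id ℝ (CoT E x))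

/-- The first structure of the pair determined by `(g, b, J₊, J₋)`:
`½ (1, 0; -b, 1) (J₊ - J₋, -(ω₋⁻¹ + ω₊⁻¹); ω₋ + ω₊, -(J₊* - J₋*)) (1, 0; b, 1)`. -/
def Quadruple.gen₁ (q : Quadruple E M) (x : M) : GenT E x →L[ℝ] GenT E x :=
  (1 / 2 : ℝ) • (shear (-q.b x)).comp
    ((blocks (q.Jp x - q.Jm x) (-((q.ωm x).inverse + (q.ωp x).inverse))
      (q.ωm x + q.ωp x) (-(dualEnd q.Jp x - dualEnd q.Jm x))).comp (shear (q.b x)))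

/-- The second structure of the pair determined by `(g, b, J₊, J₋)`:
`½ (1, 0; -b, 1) (J₋ + J₊, ω₋⁻¹ - ω₊⁻¹; -(ω₋ - ω₊), -(J₋* + J₊*)) (1, 0; b, 1)`. -/
def Quadruple.gen₂ (q : Quadruple E M) (x : M) : GenT E x →L[ℝ] GenT E x :=
  (1 / 2 : ℝ) • (shear (-q.b x)).comp
    ((blocks (q.Jm x + q.Jp x) ((q.ωm x).inverse - (q.ωp x).inverse)
      (-(q.ωm x - q.ωp x)) (-(dualEnd q.Jm x + dualEnd q.Jp x))).comp (shear (q.b x)))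

/-- The pair `(𝒥₁, 𝒥₂)` is the one determined by the almost bihermitian quadruple `q`. -/
def Quadruple.Induces [IsManifold 𝓘(ℝ, E) ∞ M] (q : Quadruple E M)
    (𝒥₁ 𝒥₂ : ∀ x : M, GenT E x →L[ℝ] GenT E x) : Prop :=
  q.IsAlmostBihermitian ∧ q.gen₁ = 𝒥₁ ∧ q.gen₂ = 𝒥₂

/-- The quadruple `g = ½ Ω(J + J₋)`, `b = -½ Ω(J - J₋)`, `J₊ = J`, `J₋ = -Ω⁻¹ J* Ω`. -/
def tamedQuadruple (Ω : ∀ x : M, TS E x →L[ℝ] CoT E x) (J : ∀ x : M, TS E x →L[ℝ] TS E x) :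
    Quadruple E M where
  g := fun x ↦ (1 / 2 : ℝ) • (Ω x).comp (J x + minusConj Ω J x)
  b := fun x ↦ -((1 / 2 : ℝ) • (Ω x).comp (J x - minusConj Ω J x))
  Jp := J
  Jm := minusConj Ω J

end Bihermitian

end GenKahler

end

/-! Let C± be the ±1-eigenbundles of 𝒢 = -𝒥₁𝒥₂. The two structures agree on C₊ and are opposite on
C₋. For the pair induced by (g, b, J₊, J₋), C₊ is the graph of g - b and C₋ the graph of -(g + b),
and under the projection to TM the structure 𝒥₂ becomes J₊ on C₊ and J₋ on C₋.

Now let 𝒥₁ = 𝒥_Ω. Since 𝒥_Ω(v, Ωw) = (w, -Ωv), C₊ must be the graph of ΩJ₊ and C₋ that of -ΩJ₋, that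
is, g - b = ΩJ₊ and g + b = ΩJ₋. Symmetry of g and skewness of b then force J₋ = -Ω⁻¹J₊*Ω, and g(v,
v) = Ω(J₊v, v) turns positivity into taming. So J₊ determines everything
(`IsSymplectic.eq_tamedQuadruple`), and each tamed J gives such a quadruple. For surjectivity
(`IsSymplectic.exists_tamed`), positivity of 𝒢 shows that ker(𝒥 - 𝒥_Ω) is the graph of ΩJ for a J
read off from the upper blocks of 𝒥.

Integrability of 𝒥 is the vanishing of its Courant-Nijenhuis expression N (`integrableGC_iff`). For
𝒥_Ω this follows from dΩ = 0. On two sections of C₊ the expressions for 𝒥 and 𝒥_Ω differ by (𝒥 -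
𝒥_Ω)r, with r the sum of the two mixed brackets, so N vanishes exactly when r lies in C₊; this is
the vanishing of the Nijenhuis tensor of J (`IsSymplectic.genNijenhuis_plus`), and C₋ gives J₋ in
the same way. Mixed arguments add no condition: ⟨N(a, b), c⟩ is cyclic, and among three sections of
C₊ or C₋ two lie in the same bundle (`Quadruple.IsAlmostBihermitian.genNijenhuis_eq_zero`). -/

noncomputable section

namespace GenKahler

/-! ### Composition, inversion and precomposition of smooth bundle maps. -/

section Bundles

open Bundle ContinuousLinearMap Topology

variable {𝕜 B F₁ F₂ F₃ : Type*} [NontriviallyNormedField 𝕜] {n : WithTop ℕ∞}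
  {E₁ : B → Type*}
  [∀ x, AddCommGroup (E₁ x)] [∀ x, Module 𝕜 (E₁ x)] [NormedAddCommGroup F₁] [NormedSpace 𝕜 F₁]
  [TopologicalSpace (TotalSpace F₁ E₁)] [∀ x, TopologicalSpace (E₁ x)]
  {E₂ : B → Type*} [∀ x, AddCommGroup (E₂ x)]
  [∀ x, Module 𝕜 (E₂ x)] [NormedAddCommGroup F₂] [NormedSpace 𝕜 F₂]
  [TopologicalSpace (TotalSpace F₂ E₂)] [∀ x, TopologicalSpace (E₂ x)]
  {E₃ : B → Type*} [∀ x, AddCommGroup (E₃ x)]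
  [∀ x, Module 𝕜 (E₃ x)] [NormedAddCommGroup F₃] [NormedSpace 𝕜 F₃]
  [TopologicalSpace (TotalSpace F₃ E₃)] [∀ x, TopologicalSpace (E₃ x)]
  {EB : Type*}
  [NormedAddCommGroup EB] [NormedSpace 𝕜 EB] {HB : Type*} [TopologicalSpace HB]
  {IB : ModelWithCorners 𝕜 EB HB} [TopologicalSpace B] [ChartedSpace HB B]
  [FiberBundle F₁ E₁] [VectorBundle 𝕜 F₁ E₁]
  [FiberBundle F₂ E₂] [VectorBundle 𝕜 F₂ E₂]
  [FiberBundle F₃ E₃] [VectorBundle 𝕜 F₃ E₃]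
  [∀ x, IsTopologicalAddGroup (E₂ x)] [∀ x, ContinuousSMul 𝕜 (E₂ x)]

/-- The composition of two `C^n` bundle maps is `C^n`. -/
theorem contMDiff_clm_bundle_comp
    [∀ x, IsTopologicalAddGroup (E₃ x)] [∀ x, ContinuousSMul 𝕜 (E₃ x)]
    {ψ : ∀ x, E₂ x →L[𝕜] E₃ x} {ϕ : ∀ x, E₁ x →L[𝕜] E₂ x}
    (hψ : ContMDiff IB (IB.prod 𝓘(𝕜, F₂ →L[𝕜] F₃)) n
      (fun m ↦ TotalSpace.mk' (F₂ →L[𝕜] F₃) (E := fun x : B ↦ (E₂ x →L[𝕜] E₃ x)) m (ψ m)))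
    (hϕ : ContMDiff IB (IB.prod 𝓘(𝕜, F₁ →L[𝕜] F₂)) n
      (fun m ↦ TotalSpace.mk' (F₁ →L[𝕜] F₂) (E := fun x : B ↦ (E₁ x →L[𝕜] E₂ x)) m (ϕ m))) :
    ContMDiff IB (IB.prod 𝓘(𝕜, F₁ →L[𝕜] F₃)) n
      (fun m ↦ TotalSpace.mk' (F₁ →L[𝕜] F₃) (E := fun x : B ↦ (E₁ x →L[𝕜] E₃ x)) m
        ((ψ m).comp (ϕ m))) := by
  intro x₀
  have h₁ := (contMDiffAt_hom_bundle _).1 (hψ x₀)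
  have h₂ := (contMDiffAt_hom_bundle _).1 (hϕ x₀)
  refine (contMDiffAt_hom_bundle _).2 ⟨contMDiffAt_id, ?_⟩
  refine (h₁.2.clm_comp h₂.2).congr_of_eventuallyEq ?_
  -- Only the middle bundle matters: its trivialization has to cancel against its inverse.
  filter_upwards [(trivializationAt F₂ E₂ x₀).open_baseSet.mem_nhds
    (FiberBundle.mem_baseSet_trivializationAt' x₀)] with x hx
  ext v
  simp [inCoordinates, hx]

/-- The pointwise inverse of an invertible `C^n` bundle map is `C^n`. -/
theorem contMDiff_clm_bundle_inverse [CompleteSpace F₁]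
    [∀ x, IsTopologicalAddGroup (E₁ x)] [∀ x, ContinuousSMul 𝕜 (E₁ x)]
    {ϕ : ∀ x, E₁ x →L[𝕜] E₂ x}
    (hϕ : ContMDiff IB (IB.prod 𝓘(𝕜, F₁ →L[𝕜] F₂)) n
      (fun m ↦ TotalSpace.mk' (F₁ →L[𝕜] F₂) (E := fun x : B ↦ (E₁ x →L[𝕜] E₂ x)) m (ϕ m)))
    (hinv : ∀ x, (ϕ x).IsInvertible) :
    ContMDiff IB (IB.prod 𝓘(𝕜, F₂ →L[𝕜] F₁)) n
      (fun m ↦ TotalSpace.mk' (F₂ →L[𝕜] F₁) (E := fun x : B ↦ (E₂ x →L[𝕜] E₁ x)) m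
        (ϕ m).inverse) := by
  intro x₀
  have h₁ := (contMDiffAt_hom_bundle _).1 (hϕ x₀)
  refine (contMDiffAt_hom_bundle _).2 ⟨contMDiffAt_id, ?_⟩
  -- In coordinates the fibrewise inverse is the inverse of the coordinate operator, so smoothness
  -- reduces to that of operator inversion at an invertible operator.
  have key : ∀ x (h1 : x ∈ (trivializationAt F₁ E₁ x₀).baseSet)
      (h2 : x ∈ (trivializationAt F₂ E₂ x₀).baseSet),
      ∃ e : F₁ ≃L[𝕜] F₂, (e : F₁ →L[𝕜] F₂) = inCoordinates F₁ E₁ F₂ E₂ x₀ x x₀ x (ϕ x) ∧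
        (e.symm : F₂ →L[𝕜] F₁) = inCoordinates F₂ E₂ F₁ E₁ x₀ x x₀ x (ϕ x).inverse := by
    intro x h1 h2
    obtain ⟨M, hM⟩ := hinv x
    refine ⟨(((trivializationAt F₁ E₁ x₀).continuousLinearEquivAt 𝕜 x h1).symm.trans M).trans
      ((trivializationAt F₂ E₂ x₀).continuousLinearEquivAt 𝕜 x h2), ?_, ?_⟩
    · rw [inCoordinates_eq h1 h2, ← hM]
      ext v; simp
    · rw [inCoordinates_eq h2 h1, ← hM, ContinuousLinearMap.inverse_equiv]
      ext v; simp
  have hx₁ := FiberBundle.mem_baseSet_trivializationAt' (F := F₁) (E := E₁) x₀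
  have hx₂ := FiberBundle.mem_baseSet_trivializationAt' (F := F₂) (E := E₂) x₀
  obtain ⟨e, he, -⟩ := key x₀ hx₁ hx₂
  have hd : ContDiffAt 𝕜 n (ContinuousLinearMap.inverse : (F₁ →L[𝕜] F₂) → (F₂ →L[𝕜] F₁))
      (inCoordinates F₁ E₁ F₂ E₂ x₀ x₀ x₀ x₀ (ϕ x₀)) := he ▸ contDiffAt_map_inverse e
  refine (hd.comp_contMDiffAt (x := x₀) h₁.2).congr_of_eventuallyEq ?_
  filter_upwards [(trivializationAt F₁ E₁ x₀).open_baseSet.mem_nhds hx₁,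
    (trivializationAt F₂ E₂ x₀).open_baseSet.mem_nhds hx₂] with x h1 h2
  obtain ⟨e, he, he'⟩ := key x h1 h2
  simp only [Function.comp_apply]
  rw [← he', ← he, ContinuousLinearMap.inverse_equiv]

/-- Precomposition with a `C^n` bundle map is a `C^n` map of hom-bundles. -/
theorem contMDiff_clm_bundle_precomp
    [∀ x, IsTopologicalAddGroup (E₃ x)] [∀ x, ContinuousSMul 𝕜 (E₃ x)]
    {ϕ : ∀ x, E₁ x →L[𝕜] E₂ x}
    (hϕ : ContMDiff IB (IB.prod 𝓘(𝕜, F₁ →L[𝕜] F₂)) n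
      (fun m ↦ TotalSpace.mk' (F₁ →L[𝕜] F₂) (E := fun x : B ↦ (E₁ x →L[𝕜] E₂ x)) m (ϕ m))) :
    ContMDiff IB (IB.prod 𝓘(𝕜, (F₂ →L[𝕜] F₃) →L[𝕜] (F₁ →L[𝕜] F₃))) n
      (fun m ↦ TotalSpace.mk' ((F₂ →L[𝕜] F₃) →L[𝕜] (F₁ →L[𝕜] F₃))
        (E := fun x : B ↦ ((E₂ x →L[𝕜] E₃ x) →L[𝕜] (E₁ x →L[𝕜] E₃ x))) m
        (ContinuousLinearMap.precomp (E₃ m) (ϕ m))) := by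
  intro x₀
  have h := (contMDiffAt_hom_bundle _).1 (hϕ x₀)
  refine (contMDiffAt_hom_bundle _).2 ⟨contMDiffAt_id, ?_⟩
  -- Precomposition depends linearly and continuously on the map precomposed with.
  have hL : ContDiff 𝕜 n (ContinuousLinearMap.compL 𝕜 F₁ F₂ F₃).flip :=
    ContinuousLinearMap.contDiff _
  refine (hL.contDiffAt.comp_contMDiffAt h.2).congr_of_eventuallyEq ?_
  filter_upwards [(trivializationAt F₁ E₁ x₀).open_baseSet.mem_nhds
    (FiberBundle.mem_baseSet_trivializationAt' x₀),
    (trivializationAt F₂ E₂ x₀).open_baseSet.mem_nhds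
    (FiberBundle.mem_baseSet_trivializationAt' x₀),
    (trivializationAt F₃ E₃ x₀).open_baseSet.mem_nhds
    (FiberBundle.mem_baseSet_trivializationAt' x₀)] with x h1 h2 h3
  let t := (trivializationAt F₂ E₂ x₀).continuousLinearMap (RingHom.id 𝕜) (trivializationAt F₃ E₃ x₀)
  -- The inverse of the hom-bundle trivialization is conjugation by the two fibre trivializations.
  have ht : ∀ ξ : F₂ →L[𝕜] F₃, t.symm x ξ = ((trivializationAt F₃ E₃ x₀).symmL 𝕜 x).comp
      (ξ.comp ((trivializationAt F₂ E₂ x₀).continuousLinearMapAt 𝕜 x)) := by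
    intro ξ
    rw [← t.symm_apply_apply_mk (b := x) ⟨h2, h3⟩ (((trivializationAt F₃ E₃ x₀).symmL 𝕜 x).comp
      (ξ.comp ((trivializationAt F₂ E₂ x₀).continuousLinearMapAt 𝕜 x)))]
    congr 1
    ext v
    simp [t, Trivialization.continuousLinearMap_apply, h2, h3]
  ext ξ v
  simp only [Function.comp_apply]
  rw [inCoordinates_eq (by simp [h2, h3]) (by simp [h1, h3])]
  simp [hom_trivializationAt, Trivialization.continuousLinearMap_apply, h1, h2, h3,
    inCoordinates, ht ξ, t]
  

end Bundles

/-! ### Global smooth sections with a prescribed value at a point. -/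

section Extension

open Bundle Topology

variable {EB : Type*} [NormedAddCommGroup EB] [NormedSpace ℝ EB] [FiniteDimensional ℝ EB]
  {B : Type*} [TopologicalSpace B] [T2Space B] [ChartedSpace EB B] [IsManifold 𝓘(ℝ, EB) ∞ B]
  (F : Type*) [NormedAddCommGroup F] [NormedSpace ℝ F]
  {V : B → Type*} [∀ x, AddCommGroup (V x)] [∀ x, Module ℝ (V x)]
  [TopologicalSpace (TotalSpace F V)] [∀ x, TopologicalSpace (V x)]
  [FiberBundle F V] [VectorBundle ℝ F V] [ContMDiffVectorBundle ∞ F V 𝓘(ℝ, EB)]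

/-- Every vector in a fibre of a smooth vector bundle is the value of a global smooth section. -/
theorem exists_contMDiff_section_eq (x : B) (v : V x) :
    ∃ s : ∀ y, V y, ContMDiff 𝓘(ℝ, EB) (𝓘(ℝ, EB).prod 𝓘(ℝ, F)) ∞
      (fun y ↦ TotalSpace.mk' F y (s y)) ∧ s x = v := by
  obtain ⟨u, hu, hs⟩ := FiberBundle.exists_contMDiffOn_extend (k := ∞) 𝓘(ℝ, EB) F v
  obtain ⟨w, hwu, hwo, hxw⟩ := mem_nhds_iff.1 hu
  -- A bump function supported where the local extension is smooth makes the product smooth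
  -- everywhere.
  obtain ⟨ψ, hψ⟩ := ((SmoothBumpFunction.nhds_basis_tsupport (I := 𝓘(ℝ, EB)) x).mem_iff).1
    (hwo.mem_nhds hxw)
  refine ⟨(ψ : B → ℝ) • FiberBundle.extend F v, ?_, ?_⟩
  · exact ContMDiffOn.smul_section_of_tsupport (ψ.contMDiff.contMDiffOn) hwo hψ.2 (hs.mono hwu)
  · simp

end Extension


/-! ### Calculus of smooth tensor fields on TM and T*M. -/

section SmoothCalculus

variable {E : Type*} [NormedAddCommGroup E] [NormedSpace ℝ E]
  {M : Type*} [TopologicalSpace M] [ChartedSpace E M] [IsManifold 𝓘(ℝ, E) ∞ M]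

variable {J K : ∀ x : M, TS E x →L[ℝ] TS E x} {B C : ∀ x : M, TS E x →L[ℝ] CoT E x}
  {β γ : ∀ x : M, CoT E x →L[ℝ] TS E x} {D D' : ∀ x : M, CoT E x →L[ℝ] CoT E x}
  {X Y : ∀ x : M, TS E x} {ξ η : ∀ x : M, CoT E x}

theorem SmoothTT.comp (h : SmoothTT J) (h' : SmoothTT K) :
    SmoothTT (fun x ↦ (J x).comp (K x)) :=
  contMDiff_clm_bundle_comp h h'

theorem SmoothTC.comp_tt (h : SmoothTC B) (h' : SmoothTT J) :
    SmoothTC (fun x ↦ (B x).comp (J x)) :=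
  contMDiff_clm_bundle_comp h h'

theorem SmoothCC.comp_tc (h : SmoothCC D) (h' : SmoothTC B) :
    SmoothTC (fun x ↦ (D x).comp (B x)) :=
  contMDiff_clm_bundle_comp h h'

theorem SmoothCT.comp_tc (h : SmoothCT β) (h' : SmoothTC B) :
    SmoothTT (fun x ↦ (β x).comp (B x)) :=
  contMDiff_clm_bundle_comp h h'

theorem SmoothTC.comp_ct (h : SmoothTC B) (h' : SmoothCT β) :
    SmoothCC (fun x ↦ (B x).comp (β x)) :=
  contMDiff_clm_bundle_comp h h'

theorem SmoothTT.comp_ct (h : SmoothTT J) (h' : SmoothCT β) :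
    SmoothCT (fun x ↦ (J x).comp (β x)) :=
  contMDiff_clm_bundle_comp h h'

theorem SmoothTC.inverse [CompleteSpace E] (h : SmoothTC B) (hB : ∀ x, (B x).IsInvertible) :
    SmoothCT (fun x ↦ (B x).inverse) :=
  contMDiff_clm_bundle_inverse h hB

theorem SmoothTT.inverse [CompleteSpace E] (h : SmoothTT J) (hJ : ∀ x, (J x).IsInvertible) :
    SmoothTT (fun x ↦ (J x).inverse) :=
  contMDiff_clm_bundle_inverse h hJ

theorem SmoothTT.apply (h : SmoothTT J) (hX : SmoothVF X) : SmoothVF (fun x ↦ J x (X x)) :=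
  ContMDiff.clm_bundle_apply h hX

theorem SmoothTC.apply (h : SmoothTC B) (hX : SmoothVF X) : SmoothCo (fun x ↦ B x (X x)) :=
  ContMDiff.clm_bundle_apply h hX

theorem SmoothCT.apply (h : SmoothCT β) (hξ : SmoothCo ξ) : SmoothVF (fun x ↦ β x (ξ x)) :=
  ContMDiff.clm_bundle_apply h hξ

theorem SmoothCC.apply (h : SmoothCC D) (hξ : SmoothCo ξ) : SmoothCo (fun x ↦ D x (ξ x)) :=
  ContMDiff.clm_bundle_apply h hξ

theorem SmoothTT.add (h : SmoothTT J) (h' : SmoothTT K) : SmoothTT (fun x ↦ J x + K x) :=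
  ContMDiff.add_section h h'
theorem SmoothTT.sub (h : SmoothTT J) (h' : SmoothTT K) : SmoothTT (fun x ↦ J x - K x) :=
  ContMDiff.sub_section h h'
theorem SmoothTT.neg (h : SmoothTT J) : SmoothTT (fun x ↦ -J x) := ContMDiff.neg_section h
theorem SmoothTT.smul (c : ℝ) (h : SmoothTT J) : SmoothTT (fun x ↦ c • J x) :=
  ContMDiff.const_smul_section h

theorem SmoothTC.add (h : SmoothTC B) (h' : SmoothTC C) : SmoothTC (fun x ↦ B x + C x) :=
  ContMDiff.add_section h h'
theorem SmoothTC.sub (h : SmoothTC B) (h' : SmoothTC C) : SmoothTC (fun x ↦ B x - C x) :=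
  ContMDiff.sub_section h h'
theorem SmoothTC.neg (h : SmoothTC B) : SmoothTC (fun x ↦ -B x) := ContMDiff.neg_section h
theorem SmoothTC.smul (c : ℝ) (h : SmoothTC B) : SmoothTC (fun x ↦ c • B x) :=
  ContMDiff.const_smul_section h

theorem SmoothCT.add (h : SmoothCT β) (h' : SmoothCT γ) : SmoothCT (fun x ↦ β x + γ x) :=
  ContMDiff.add_section h h'
theorem SmoothCT.sub (h : SmoothCT β) (h' : SmoothCT γ) : SmoothCT (fun x ↦ β x - γ x) :=
  ContMDiff.sub_section h h'
theorem SmoothCT.neg (h : SmoothCT β) : SmoothCT (fun x ↦ -β x) := ContMDiff.neg_section h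
theorem SmoothCT.smul (c : ℝ) (h : SmoothCT β) : SmoothCT (fun x ↦ c • β x) :=
  ContMDiff.const_smul_section h

theorem SmoothCC.neg (h : SmoothCC D) : SmoothCC (fun x ↦ -D x) := ContMDiff.neg_section h

theorem SmoothVF.add (h : SmoothVF X) (h' : SmoothVF Y) : SmoothVF (fun x ↦ X x + Y x) :=
  ContMDiff.add_section h h'
theorem SmoothVF.neg (h : SmoothVF X) : SmoothVF (fun x ↦ -X x) := ContMDiff.neg_section h

theorem SmoothCo.add (h : SmoothCo ξ) (h' : SmoothCo η) : SmoothCo (fun x ↦ ξ x + η x) :=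
  ContMDiff.add_section h h'
theorem SmoothCo.neg (h : SmoothCo ξ) : SmoothCo (fun x ↦ -ξ x) := ContMDiff.neg_section h

theorem smoothCo_zero : SmoothCo (fun x : M ↦ (0 : CoT E x)) :=
  Bundle.contMDiff_zeroSection (F := E →L[ℝ] ℝ) ℝ (fun x : M ↦ CoT E x)

theorem smoothVF_zero : SmoothVF (fun x : M ↦ (0 : TS E x)) :=
  Bundle.contMDiff_zeroSection (F := E) ℝ (fun x : M ↦ TS E x)
theorem smoothTT_zero : SmoothTT (fun x : M ↦ (0 : TS E x →L[ℝ] TS E x)) :=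
  Bundle.contMDiff_zeroSection (F := E →L[ℝ] E) ℝ (fun x : M ↦ TS E x →L[ℝ] TS E x)
theorem smoothCC_zero : SmoothCC (fun x : M ↦ (0 : CoT E x →L[ℝ] CoT E x)) :=
  Bundle.contMDiff_zeroSection (F := (E →L[ℝ] ℝ) →L[ℝ] (E →L[ℝ] ℝ)) ℝ
    (fun x : M ↦ CoT E x →L[ℝ] CoT E x)

/-- The identity of the tangent bundle is smooth. -/
theorem smoothTT_id : SmoothTT (fun x : M ↦ ContinuousLinearMap.id ℝ (TS E x)) := by
  intro x₀
  refine (contMDiffAt_hom_bundle _).2 ⟨contMDiffAt_id, ?_⟩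
  refine (contMDiffAt_const (c := ContinuousLinearMap.id ℝ E)).congr_of_eventuallyEq ?_
  filter_upwards [(trivializationAt E (fun x : M ↦ TS E x) x₀).open_baseSet.mem_nhds
    (FiberBundle.mem_baseSet_trivializationAt' x₀)] with x hx
  rw [ContinuousLinearMap.inCoordinates_eq hx hx]
  ext v
  simp

/-- The pairing of a smooth 1-form with a smooth vector field is smooth. -/
theorem SmoothCo.pair (hξ : SmoothCo ξ) (hX : SmoothVF X) :
    ContMDiff 𝓘(ℝ, E) 𝓘(ℝ, ℝ) ∞ (fun x ↦ ξ x (X x)) := by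
  have h : ContMDiff 𝓘(ℝ, E) (𝓘(ℝ, E).prod 𝓘(ℝ, ℝ)) ∞
      (fun x ↦ Bundle.TotalSpace.mk' ℝ (E := Bundle.Trivial M ℝ) x (ξ x (X x))) :=
    ContMDiff.clm_bundle_apply (E₂ := Bundle.Trivial M ℝ) hξ hX
  intro x
  exact (Bundle.contMDiffAt_section _).1 (h x)

/-- The dual of a smooth endomorphism of the tangent bundle is smooth. -/
theorem SmoothTT.dualEnd (hJ : SmoothTT J) : SmoothCC (GenKahler.dualEnd J) := by
  exact contMDiff_clm_bundle_precomp (E₃ := Bundle.Trivial M ℝ) hJ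

end SmoothCalculus


/-! ### Lie brackets and exterior derivatives in the preferred chart. -/

section Chart

open Topology

variable {E : Type*} [NormedAddCommGroup E] [NormedSpace ℝ E]
  {M : Type*} [TopologicalSpace M] [ChartedSpace E M]

set_option linter.unusedSectionVars false

/-- The vector field `X` written in the preferred chart around `x`. -/
def chartVF (X : ∀ x : M, TS E x) (x : M) (y : E) : E :=
  mfderiv 𝓘(ℝ, E) 𝓘(ℝ, E) (extChartAt 𝓘(ℝ, E) x) ((extChartAt 𝓘(ℝ, E) x).symm y)
    (X ((extChartAt 𝓘(ℝ, E) x).symm y))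

variable [IsManifold 𝓘(ℝ, E) ∞ M]

theorem target_mem_nhds (x : M) :
    (extChartAt 𝓘(ℝ, E) x).target ∈ 𝓝 (extChartAt 𝓘(ℝ, E) x x) :=
  extChartAt_target_mem_nhds x

theorem isManifold_one : IsManifold 𝓘(ℝ, E) 1 M := IsManifold.of_le (n := ∞) (by simp)

theorem mfderiv_symm_mfderiv {x : M} {y : E} (hy : y ∈ (extChartAt 𝓘(ℝ, E) x).target)
    (v : TS E ((extChartAt 𝓘(ℝ, E) x).symm y)) :
    mfderiv 𝓘(ℝ, E) 𝓘(ℝ, E) (extChartAt 𝓘(ℝ, E) x).symm y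
      (mfderiv 𝓘(ℝ, E) 𝓘(ℝ, E) (extChartAt 𝓘(ℝ, E) x) ((extChartAt 𝓘(ℝ, E) x).symm y) v) = v := by
  have : IsManifold 𝓘(ℝ, E) 1 M := isManifold_one
  have h := mfderivWithin_extChartAt_symm_comp_mfderiv_extChartAt (I := 𝓘(ℝ, E)) hy
  rw [modelWithCornersSelf_coe, Set.range_id, mfderivWithin_univ] at h
  exact congrArg (fun A ↦ A v) h

/-- The tangent space at x is identified with E through the preferred chart at x itself. -/
theorem mfderiv_chart_self (x : M) (v : TS E x) :
    mfderiv 𝓘(ℝ, E) 𝓘(ℝ, E) (extChartAt 𝓘(ℝ, E) x) x v = v := by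
  have : IsManifold 𝓘(ℝ, E) 1 M := isManifold_one
  rw [mfderiv_extChartAt_self]
  rfl

theorem mfderiv_chart_symm_self (x : M) (v : E) :
    mfderiv 𝓘(ℝ, E) 𝓘(ℝ, E) (extChartAt 𝓘(ℝ, E) x).symm (extChartAt 𝓘(ℝ, E) x x) v = v := by
  have : IsManifold 𝓘(ℝ, E) 1 M := isManifold_one
  have h := mfderivWithin_range_extChartAt_symm (I := 𝓘(ℝ, E)) (x := x)
  rw [modelWithCornersSelf_coe, Set.range_id, mfderivWithin_univ] at h
  rw [h]
  rfl

theorem differentiableAt_comp_chart_symm {F : Type*} [NormedAddCommGroup F] [NormedSpace ℝ F]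
    {f : M → F} {x : M} (hf : ContMDiffAt 𝓘(ℝ, E) 𝓘(ℝ, F) ∞ f x) :
    DifferentiableAt ℝ (fun y ↦ f ((extChartAt 𝓘(ℝ, E) x).symm y)) (extChartAt 𝓘(ℝ, E) x x) := by
  have h := (hf.mdifferentiableAt (by simp)).differentiableWithinAt_writtenInExtChartAt
  rw [modelWithCornersSelf_coe, Set.range_id, differentiableWithinAt_univ] at h
  exact h

theorem mvfderiv_eq_fderiv {F : Type*} [NormedAddCommGroup F] [NormedSpace ℝ F]
    {f : M → F} {x : M} (hf : ContMDiffAt 𝓘(ℝ, E) 𝓘(ℝ, F) ∞ f x) (v : TS E x) :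
    mvfderiv 𝓘(ℝ, E) f x v =
      fderiv ℝ (fun y ↦ f ((extChartAt 𝓘(ℝ, E) x).symm y)) (extChartAt 𝓘(ℝ, E) x x) v := by
  have h := (hf.mdifferentiableAt (by simp)).mvfderiv
  rw [modelWithCornersSelf_coe, Set.range_id, fderivWithin_univ] at h
  rw [h]
  rfl

theorem chartVF_self (X : ∀ x : M, TS E x) (x : M) :
    chartVF X x (extChartAt 𝓘(ℝ, E) x x) = X x := by
  -- The inverse chart returns to x only propositionally, so the fibre type is handled by letting
  -- the base point vary.
  have h : ∀ z, z = x → (mfderiv 𝓘(ℝ, E) 𝓘(ℝ, E) (extChartAt 𝓘(ℝ, E) x) z (X z) : E) = X x := by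
    rintro z rfl
    exact mfderiv_chart_self z _
  exact h _ (extChartAt_to_inv x)

/-- On the chart target `chartVF` is the fibre coordinate of `X` in the tangent trivialization at x.
-/
theorem SmoothVF.differentiableAt_chartVF {X : ∀ x : M, TS E x} (hX : SmoothVF X) (x : M) :
    DifferentiableAt ℝ (chartVF X x) (extChartAt 𝓘(ℝ, E) x x) := by
  have : IsManifold 𝓘(ℝ, E) 1 M := isManifold_one
  have h := (Bundle.contMDiffAt_section _).1 (hX x)
  refine (differentiableAt_comp_chart_symm h).congr_of_eventuallyEq ?_
  filter_upwards [target_mem_nhds x] with y hy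
  have hs := (extChartAt 𝓘(ℝ, E) x).map_target hy
  rw [extChartAt_source] at hs
  have hb : (extChartAt 𝓘(ℝ, E) x).symm y ∈
    (trivializationAt E (TangentSpace 𝓘(ℝ, E)) x).baseSet := by simpa using hs
  have h1 := congrArg (fun A : TS E ((extChartAt 𝓘(ℝ, E) x).symm y) →L[ℝ] E ↦
      A (X ((extChartAt 𝓘(ℝ, E) x).symm y)))
    (TangentBundle.continuousLinearMapAt_trivializationAt (I := 𝓘(ℝ, E)) hs)
  refine h1.symm.trans ?_
  exact congrFun (Bundle.Trivialization.coe_linearMapAt_of_mem (R := ℝ) _ hb)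
    (X ((extChartAt 𝓘(ℝ, E) x).symm y))

/-- The manifold bracket is built from pullbacks along the inverse chart. Near the centre these are
the `chartVF`, and at the centre the chart derivative is the identity. -/
theorem mlieBracket_eq_chart {X Y : ∀ x : M, TS E x} (x : M) :
    VectorField.mlieBracket 𝓘(ℝ, E) X Y x =
      VectorField.lieBracket ℝ (chartVF X x) (chartVF Y x) (extChartAt 𝓘(ℝ, E) x x) := by
  have : IsManifold 𝓘(ℝ, E) 1 M := isManifold_one
  have key : ∀ Z : ∀ x : M, TS E x, VectorField.mpullbackWithin 𝓘(ℝ, E) 𝓘(ℝ, E)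
      (extChartAt 𝓘(ℝ, E) x).symm Z (Set.range 𝓘(ℝ, E)) =ᶠ[𝓝 (extChartAt 𝓘(ℝ, E) x x)]
      chartVF Z x := by
    intro Z
    filter_upwards [target_mem_nhds x] with y hy
    rw [VectorField.mpullbackWithin_apply]
    have h1 := mfderivWithin_extChartAt_symm_comp_mfderiv_extChartAt (I := 𝓘(ℝ, E)) hy
    have h2 := mfderiv_extChartAt_comp_mfderivWithin_extChartAt_symm (I := 𝓘(ℝ, E)) hy
    rw [ContinuousLinearMap.inverse_eq h1 h2]
    rfl
  rw [← VectorField.mlieBracketWithin_univ, VectorField.mlieBracketWithin_apply]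
  rw [mfderiv_extChartAt_self]
  simp only [Set.preimage_univ, modelWithCornersSelf_coe, Set.range_id, Set.inter_self]
  have h := Filter.EventuallyEq.lieBracket_vectorField_eq (𝕜 := ℝ) (key X) (key Y)
  simp only [modelWithCornersSelf_coe, Set.range_id] at h
  rw [← h]
  have hid : ∀ w : E, (ContinuousLinearMap.id ℝ E).inverse w = w := by simp
  exact (hid _).trans (congrFun (VectorField.lieBracketWithin_univ (𝕜 := ℝ)) _)

theorem symmL_eq_mfderiv {x : M} {y : E} (hy : y ∈ (extChartAt 𝓘(ℝ, E) x).target) (v : E) :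
    (trivializationAt E (TangentSpace 𝓘(ℝ, E)) x).symm ((extChartAt 𝓘(ℝ, E) x).symm y) v =
      mfderiv 𝓘(ℝ, E) 𝓘(ℝ, E) (extChartAt 𝓘(ℝ, E) x).symm y v := by
  have : IsManifold 𝓘(ℝ, E) 1 M := isManifold_one
  have hs := (extChartAt 𝓘(ℝ, E) x).map_target hy
  rw [extChartAt_source] at hs
  have hb : (extChartAt 𝓘(ℝ, E) x).symm y ∈
    (trivializationAt E (TangentSpace 𝓘(ℝ, E)) x).baseSet := by simpa using hs
  have h := TangentBundle.symmL_trivializationAt (I := 𝓘(ℝ, E)) hs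
  rw [modelWithCornersSelf_coe, Set.range_id, mfderivWithin_univ] at h
  have h2 : ∀ z, z = y → (mfderiv 𝓘(ℝ, E) 𝓘(ℝ, E) (extChartAt 𝓘(ℝ, E) x).symm z v : E) =
      mfderiv 𝓘(ℝ, E) 𝓘(ℝ, E) (extChartAt 𝓘(ℝ, E) x).symm y v := by
    rintro z rfl; rfl
  rw [← Bundle.Trivialization.symmL_apply (R := ℝ) _ hb]
  exact (congrArg (fun A : E →L[ℝ] E ↦ A v) h).trans
    (h2 _ ((extChartAt 𝓘(ℝ, E) x).right_inv hy))

theorem SmoothCo.differentiableAt_chartCo {ξ : ∀ x : M, CoT E x} (hξ : SmoothCo ξ) (x : M) :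
    DifferentiableAt ℝ (chartCo ξ x) (extChartAt 𝓘(ℝ, E) x x) := by
  have : IsManifold 𝓘(ℝ, E) 1 M := isManifold_one
  have h := ((contMDiffAt_hom_bundle _).1 (hξ x)).2
  refine (differentiableAt_comp_chart_symm h).congr_of_eventuallyEq ?_
  filter_upwards [target_mem_nhds x] with y hy
  have hs := (extChartAt 𝓘(ℝ, E) x).map_target hy
  rw [extChartAt_source] at hs
  have hb : (extChartAt 𝓘(ℝ, E) x).symm y ∈
    (trivializationAt E (TangentSpace 𝓘(ℝ, E)) x).baseSet := by simpa using hs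
  ext v
  have h2 : chartCo ξ x y v = ξ ((extChartAt 𝓘(ℝ, E) x).symm y)
    (mfderiv 𝓘(ℝ, E) 𝓘(ℝ, E) (extChartAt 𝓘(ℝ, E) x).symm y v) := rfl
  rw [h2, ← symmL_eq_mfderiv hy, ← Bundle.Trivialization.symmL_apply (R := ℝ) _ hb]
  simp [ContinuousLinearMap.inCoordinates]
  rfl

theorem SmoothTC.differentiableAt_chartBil {B : ∀ x : M, TS E x →L[ℝ] CoT E x} (hB : SmoothTC B)
    (x : M) : DifferentiableAt ℝ (chartBil B x) (extChartAt 𝓘(ℝ, E) x x) := by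
  have : IsManifold 𝓘(ℝ, E) 1 M := isManifold_one
  have h := ((contMDiffAt_hom_bundle _).1 (hB x)).2
  refine (differentiableAt_comp_chart_symm h).congr_of_eventuallyEq ?_
  filter_upwards [target_mem_nhds x] with y hy
  have hs := (extChartAt 𝓘(ℝ, E) x).map_target hy
  rw [extChartAt_source] at hs
  ext v w
  have hb : (extChartAt 𝓘(ℝ, E) x).symm y ∈
    (trivializationAt E (TangentSpace 𝓘(ℝ, E)) x).baseSet := by simpa using hs
  have h2 : chartBil B x y v w = B ((extChartAt 𝓘(ℝ, E) x).symm y)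
    (mfderiv 𝓘(ℝ, E) 𝓘(ℝ, E) (extChartAt 𝓘(ℝ, E) x).symm y v)
    (mfderiv 𝓘(ℝ, E) 𝓘(ℝ, E) (extChartAt 𝓘(ℝ, E) x).symm y w) := rfl
  have := inCoordinates_apply_eq₂ (𝕜 := ℝ) (F₁ := E) (E₁ := fun x : M ↦ TangentSpace 𝓘(ℝ, E) x)
    (F₂ := E) (E₂ := fun x : M ↦ TangentSpace 𝓘(ℝ, E) x) (F₃ := ℝ) (E₃ := Bundle.Trivial M ℝ)
    (x₀ := x) (ϕ := B ((extChartAt 𝓘(ℝ, E) x).symm y)) (v := v) (w := w) hb hb (by simp)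
  rw [h2, ← symmL_eq_mfderiv hy, ← symmL_eq_mfderiv hy]
  have h3 := this.symm
  simp only [Bundle.Trivial.fiberBundle_trivializationAt',
    Bundle.Trivial.linearMapAt_trivialization, LinearMap.id_coe, id] at h3
  exact h3

theorem chartCo_chartVF (ξ : ∀ x : M, CoT E x) (X : ∀ x : M, TS E x) {x : M} {y : E}
    (hy : y ∈ (extChartAt 𝓘(ℝ, E) x).target) :
    chartCo ξ x y (chartVF X x y) =
      ξ ((extChartAt 𝓘(ℝ, E) x).symm y) (X ((extChartAt 𝓘(ℝ, E) x).symm y)) :=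
  congrArg (ξ ((extChartAt 𝓘(ℝ, E) x).symm y)) (mfderiv_symm_mfderiv hy _)

theorem chartBil_chartVF (B : ∀ x : M, TS E x →L[ℝ] CoT E x) (X Y : ∀ x : M, TS E x) {x : M} {y : E}
    (hy : y ∈ (extChartAt 𝓘(ℝ, E) x).target) :
    chartBil B x y (chartVF X x y) (chartVF Y x y) =
      B ((extChartAt 𝓘(ℝ, E) x).symm y) (X ((extChartAt 𝓘(ℝ, E) x).symm y))
        (Y ((extChartAt 𝓘(ℝ, E) x).symm y)) :=
  congrArg₂ (fun v w ↦ B ((extChartAt 𝓘(ℝ, E) x).symm y) v w)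
    (mfderiv_symm_mfderiv hy _) (mfderiv_symm_mfderiv hy _)

theorem chartCo_self (ξ : ∀ x : M, CoT E x) (x : M) (v : E) :
    chartCo ξ x (extChartAt 𝓘(ℝ, E) x x) v = ξ x v := by
  have h : ∀ z, z = x → ∀ w : E, w = v → (ξ z w : ℝ) = ξ x v := by
    rintro z rfl w rfl; rfl
  exact h _ (extChartAt_to_inv x) _ (mfderiv_chart_symm_self x v)

theorem chartBil_self (B : ∀ x : M, TS E x →L[ℝ] CoT E x) (x : M) (v w : E) :
    chartBil B x (extChartAt 𝓘(ℝ, E) x x) v w = B x v w := by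
  have h : ∀ z, z = x → ∀ v' : E, v' = v → ∀ w' : E, w' = w → (B z v' w' : ℝ) = B x v w := by
    rintro z rfl v' rfl w' rfl; rfl
  exact h ((extChartAt 𝓘(ℝ, E) x).symm (extChartAt 𝓘(ℝ, E) x x)) (extChartAt_to_inv x)
    (mfderiv 𝓘(ℝ, E) 𝓘(ℝ, E) (extChartAt 𝓘(ℝ, E) x).symm (extChartAt 𝓘(ℝ, E) x x) v)
    (mfderiv_chart_symm_self x v)
    (mfderiv 𝓘(ℝ, E) 𝓘(ℝ, E) (extChartAt 𝓘(ℝ, E) x).symm (extChartAt 𝓘(ℝ, E) x x) w)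
    (mfderiv_chart_symm_self x w)

/-- The derivative of the function `ξ(X)`, in the preferred chart. -/
theorem mvfderiv_pair {ξ : ∀ x : M, CoT E x} {X : ∀ x : M, TS E x} (hξ : SmoothCo ξ)
    (hX : SmoothVF X) (x : M) (v : TS E x) :
    mvfderiv 𝓘(ℝ, E) (fun y ↦ ξ y (X y)) x v =
      fderiv ℝ (chartCo ξ x) (extChartAt 𝓘(ℝ, E) x x) v (X x) +
        ξ x (fderiv ℝ (chartVF X x) (extChartAt 𝓘(ℝ, E) x x) v) := by
  rw [mvfderiv_eq_fderiv (hξ.pair hX x)]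
  -- The derivatives of chart and inverse chart cancel on the target, so the function is the pairing
  -- of the two chart expressions and the product rule applies.
  have h : (fun y ↦ ξ ((extChartAt 𝓘(ℝ, E) x).symm y) (X ((extChartAt 𝓘(ℝ, E) x).symm y)))
      =ᶠ[𝓝 (extChartAt 𝓘(ℝ, E) x x)] fun y ↦ chartCo ξ x y (chartVF X x y) := by
    filter_upwards [target_mem_nhds x] with y hy
    exact (chartCo_chartVF ξ X hy).symm
  have h3 : ∀ v : E, fderiv ℝ (fun y ↦ chartCo ξ x y (chartVF X x y)) (extChartAt 𝓘(ℝ, E) x x) v =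
      fderiv ℝ (chartCo ξ x) (extChartAt 𝓘(ℝ, E) x x) v (chartVF X x (extChartAt 𝓘(ℝ, E) x x)) +
      chartCo ξ x (extChartAt 𝓘(ℝ, E) x x)
        (fderiv ℝ (chartVF X x) (extChartAt 𝓘(ℝ, E) x x) v) := by
    intro v
    rw [fderiv_clm_apply (hξ.differentiableAt_chartCo x) (hX.differentiableAt_chartVF x)]
    simp [add_comm]
  simp only [chartCo_self, chartVF_self] at h3
  exact (congrArg (fun A : E →L[ℝ] ℝ ↦ A v) h.fderiv_eq).trans (h3 v)

/-- The exterior derivative of a 1-form by Cartan's formula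
`dξ(X, Y) = X(ξ(Y)) - Y(ξ(X)) - ξ([X, Y])`. -/
theorem dCo_apply {ξ : ∀ x : M, CoT E x} {X Y : ∀ x : M, TS E x} (hξ : SmoothCo ξ)
    (hX : SmoothVF X) (hY : SmoothVF Y) (x : M) :
    dCo ξ x (X x) (Y x) = mvfderiv 𝓘(ℝ, E) (fun y ↦ ξ y (Y y)) x (X x)
      - mvfderiv 𝓘(ℝ, E) (fun y ↦ ξ y (X y)) x (Y x)
      - ξ x (VectorField.mlieBracket 𝓘(ℝ, E) X Y x) := by
  rw [mvfderiv_pair hξ hY, mvfderiv_pair hξ hX, mlieBracket_eq_chart]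
  have h1 : dCo ξ x (X x) (Y x) = fderiv ℝ (chartCo ξ x) (extChartAt 𝓘(ℝ, E) x x) (X x) (Y x) -
      fderiv ℝ (chartCo ξ x) (extChartAt 𝓘(ℝ, E) x x) (Y x) (X x) := by
    have h := mfderiv_chart_self x (X x)
    have h' := mfderiv_chart_self x (Y x)
    exact congrArg₂ (fun v w : E ↦ fderiv ℝ (chartCo ξ x) (extChartAt 𝓘(ℝ, E) x x) v w -
      fderiv ℝ (chartCo ξ x) (extChartAt 𝓘(ℝ, E) x x) w v) h h'
  have h2 : ∀ v w : E, ξ x (v - w : E) = (ξ x v : ℝ) - ξ x w := fun v w ↦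
    map_sub (ξ x) (v : TS E x) (w : TS E x)
  simp only [VectorField.lieBracket]
  rw [h1, h2]
  simp only [chartVF_self]
  ring

theorem mvfderiv_bil {B : ∀ x : M, TS E x →L[ℝ] CoT E x} {X Y : ∀ x : M, TS E x} (hB : SmoothTC B)
    (hX : SmoothVF X) (hY : SmoothVF Y) (x : M) (v : TS E x) :
    mvfderiv 𝓘(ℝ, E) (fun y ↦ B y (X y) (Y y)) x v =
      fderiv ℝ (chartBil B x) (extChartAt 𝓘(ℝ, E) x x) v (X x) (Y x) +
        B x (fderiv ℝ (chartVF X x) (extChartAt 𝓘(ℝ, E) x x) v) (Y x) +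
        B x (X x) (fderiv ℝ (chartVF Y x) (extChartAt 𝓘(ℝ, E) x x) v) := by
  rw [mvfderiv_eq_fderiv ((hB.apply hX).pair hY x)]
  have h : (fun y ↦ B ((extChartAt 𝓘(ℝ, E) x).symm y) (X ((extChartAt 𝓘(ℝ, E) x).symm y))
        (Y ((extChartAt 𝓘(ℝ, E) x).symm y)))
      =ᶠ[𝓝 (extChartAt 𝓘(ℝ, E) x x)] fun y ↦ chartBil B x y (chartVF X x y) (chartVF Y x y) := by
    filter_upwards [target_mem_nhds x] with y hy
    exact (chartBil_chartVF B X Y hy).symm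
  have dB := hB.differentiableAt_chartBil x
  have dX := hX.differentiableAt_chartVF x
  have h3 : ∀ v : E, fderiv ℝ (fun y ↦ chartBil B x y (chartVF X x y) (chartVF Y x y))
        (extChartAt 𝓘(ℝ, E) x x) v =
      fderiv ℝ (chartBil B x) (extChartAt 𝓘(ℝ, E) x x) v (chartVF X x (extChartAt 𝓘(ℝ, E) x x))
        (chartVF Y x (extChartAt 𝓘(ℝ, E) x x)) +
      chartBil B x (extChartAt 𝓘(ℝ, E) x x)
        (fderiv ℝ (chartVF X x) (extChartAt 𝓘(ℝ, E) x x) v)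
        (chartVF Y x (extChartAt 𝓘(ℝ, E) x x)) +
      chartBil B x (extChartAt 𝓘(ℝ, E) x x) (chartVF X x (extChartAt 𝓘(ℝ, E) x x))
        (fderiv ℝ (chartVF Y x) (extChartAt 𝓘(ℝ, E) x x) v) := by
    intro v
    rw [fderiv_clm_apply (dB.clm_apply dX) (hY.differentiableAt_chartVF x), fderiv_clm_apply dB dX]
    simp only [add_apply, ContinuousLinearMap.comp_apply, ContinuousLinearMap.flip_apply]
    ring
  simp only [chartBil_self] at h3
  simp only [chartVF_self] at h3
  exact (congrArg (fun A : E →L[ℝ] ℝ ↦ A v) h.fderiv_eq).trans (h3 v)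

set_option synthInstance.maxHeartbeats 200000 in
/-- The terms of `dB(X, Y, Z)` involving derivatives of the vector fields cancel. -/
theorem closed_algebra (b : E →L[ℝ] E →L[ℝ] ℝ) (b' : E →L[ℝ] E →L[ℝ] E →L[ℝ] ℝ)
    (hb : ∀ v, b v v = 0) (hb' : ∀ u v w, b' u v w - b' v u w + b' w u v = 0)
    (X Y Z : E) (X' Y' Z' : E →L[ℝ] E) :
    (b' X Y Z + b (Y' X) Z + b Y (Z' X)) - (b' Y X Z + b (X' Y) Z + b X (Z' Y))
      + (b' Z X Y + b (X' Z) Y + b X (Y' Z)) - b (Y' X - X' Y) Z + b (Z' X - X' Z) Y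
      - b (Z' Y - Y' Z) X = 0 := by
  have skew : ∀ v w, b v w = -b w v := by
    intro v w
    have h := hb (v + w)
    simp only [map_add, add_apply, hb] at h
    linarith
  simp only [map_sub, sub_apply]
  rw [skew Y, skew X, skew X]
  linarith [hb' X Y Z]

set_option synthInstance.maxHeartbeats 200000 in
/-- The invariant formula for the exterior derivative of a 2-form, for a closed form. -/
theorem ClosedBil.invariant {B : ∀ x : M, TS E x →L[ℝ] CoT E x} (hc : ClosedBil B)
    (hB : SmoothTC B) (halt : ∀ x (v : TS E x), B x v v = 0) {X Y Z : ∀ x : M, TS E x}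
    (hX : SmoothVF X) (hY : SmoothVF Y) (hZ : SmoothVF Z) (x : M) :
    mvfderiv 𝓘(ℝ, E) (fun y ↦ B y (Y y) (Z y)) x (X x)
      - mvfderiv 𝓘(ℝ, E) (fun y ↦ B y (X y) (Z y)) x (Y x)
      + mvfderiv 𝓘(ℝ, E) (fun y ↦ B y (X y) (Y y)) x (Z x)
      - B x (VectorField.mlieBracket 𝓘(ℝ, E) X Y x) (Z x)
      + B x (VectorField.mlieBracket 𝓘(ℝ, E) X Z x) (Y x)
      - B x (VectorField.mlieBracket 𝓘(ℝ, E) Y Z x) (X x) = 0 := by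
  rw [mvfderiv_bil hB hY hZ, mvfderiv_bil hB hX hZ, mvfderiv_bil hB hX hY,
    mlieBracket_eq_chart, mlieBracket_eq_chart, mlieBracket_eq_chart]
  simp only [VectorField.lieBracket, chartVF_self]
  exact closed_algebra (E := E) (B x) (fderiv ℝ (chartBil B x) (extChartAt 𝓘(ℝ, E) x x)) (halt x)
    (hc x) (X x) (Y x) (Z x) (fderiv ℝ (chartVF X x) (extChartAt 𝓘(ℝ, E) x x))
    (fderiv ℝ (chartVF Y x) (extChartAt 𝓘(ℝ, E) x x))
    (fderiv ℝ (chartVF Z x) (extChartAt 𝓘(ℝ, E) x x))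

end Chart


/-! ### The Courant bracket and its Nijenhuis expression. -/

section Courant

variable {E : Type*} [NormedAddCommGroup E] [NormedSpace ℝ E]
  {M : Type*} [TopologicalSpace M] [ChartedSpace E M]

theorem gen_map_add {x : M} (A : GenT E x →L[ℝ] GenT E x) (u v : GenT E x) :
    A (u + v) = A u + A v := A.toLinearMap.map_add u v

theorem gen_map_neg {x : M} (A : GenT E x →L[ℝ] GenT E x) (u : GenT E x) :
    A (-u) = -A u := A.toLinearMap.map_neg u

theorem pairing_add_left {x : M} (u u' v : GenT E x) :
    pairing (u + u') v = pairing u v + pairing u' v := by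
  simp only [pairing, Prod.fst_add, Prod.snd_add, add_apply, map_add]; ring

theorem pairing_neg_left {x : M} (u v : GenT E x) : pairing (-u) v = -pairing u v := by
  simp only [pairing, Prod.fst_neg, Prod.snd_neg, neg_apply, map_neg]; ring

theorem pairing_sub_left {x : M} (u u' v : GenT E x) :
    pairing (u - u') v = pairing u v - pairing u' v := by
  rw [sub_eq_add_neg, pairing_add_left, pairing_neg_left]; ring

theorem pairing_comm {x : M} (u v : GenT E x) : pairing u v = pairing v u := by
  simp only [pairing]; ring

theorem pairing_add_right {x : M} (u v v' : GenT E x) :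
    pairing u (v + v') = pairing u v + pairing u v' := by
  rw [pairing_comm, pairing_add_left, pairing_comm v, pairing_comm v']

theorem pairing_neg_right {x : M} (u v : GenT E x) : pairing u (-v) = -pairing u v := by
  rw [pairing_comm, pairing_neg_left, pairing_comm]

theorem courant_swap (u v : ∀ x : M, GenT E x) (x : M) : courant u v x = -courant v u x := by
  have h : (fun y ↦ (v y).2 (u y).1 - (u y).2 (v y).1) =
      -(fun y ↦ (u y).2 (v y).1 - (v y).2 (u y).1) := by
    ext y; simp
  refine Prod.ext ?_ ?_
  · exact VectorField.mlieBracket_swap_apply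
  · simp only [courant, Prod.snd_neg]
    rw [h, mvfderiv_neg]
    simp only [smul_neg, neg_add, neg_sub]

variable [IsManifold 𝓘(ℝ, E) ∞ M]

theorem SmoothGen.add {u v : ∀ x : M, GenT E x} (hu : SmoothGen u) (hv : SmoothGen v) :
    SmoothGen (fun x ↦ u x + v x) :=
  ⟨SmoothVF.add hu.1 hv.1, SmoothCo.add hu.2 hv.2⟩

theorem SmoothGenEnd.apply {𝒥 : ∀ x : M, GenT E x →L[ℝ] GenT E x} (h𝒥 : SmoothGenEnd 𝒥)
    {u : ∀ x : M, GenT E x} (hu : SmoothGen u) : SmoothGen (fun x ↦ 𝒥 x (u x)) := by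
  have key : ∀ x, 𝒥 x (u x) = 𝒥 x ((u x).1, 0) + 𝒥 x (0, (u x).2) := by
    intro x
    rw [← gen_map_add]
    simp
  constructor
  · have h : (fun x ↦ (𝒥 x (u x)).1) = fun x ↦ (𝒥 x ((u x).1, 0)).1 + (𝒥 x (0, (u x).2)).1 := by
      ext x; rw [key]; rfl
    rw [h]
    exact (h𝒥.1.apply hu.1).add (h𝒥.2.1.apply hu.2)
  · have h : (fun x ↦ (𝒥 x (u x)).2) = fun x ↦ (𝒥 x ((u x).1, 0)).2 + (𝒥 x (0, (u x).2)).2 := by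
      ext x : 1; rw [key]; rfl
    rw [h]
    exact (h𝒥.2.2.1.apply hu.1).add (h𝒥.2.2.2.apply hu.2)

theorem SmoothVF.mdifferentiableAt {X : ∀ x : M, TS E x} (hX : SmoothVF X) (x : M) :
    MDifferentiableAt 𝓘(ℝ, E) (𝓘(ℝ, E).prod 𝓘(ℝ, E))
      (fun x ↦ Bundle.TotalSpace.mk' E (E := fun x : M ↦ TS E x) x (X x)) x :=
  (hX x).mdifferentiableAt (by simp)

theorem dCo_add {ξ η : ∀ x : M, CoT E x} (hξ : SmoothCo ξ) (hη : SmoothCo η) (x : M) (v : TS E x) :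
    dCo (fun y ↦ ξ y + η y) x v = dCo ξ x v + dCo η x v := by
  have h : fderiv ℝ (chartCo (fun y ↦ ξ y + η y) x) (extChartAt 𝓘(ℝ, E) x x) =
      fderiv ℝ (chartCo ξ x) (extChartAt 𝓘(ℝ, E) x x) +
      fderiv ℝ (chartCo η x) (extChartAt 𝓘(ℝ, E) x x) := by
    rw [← fderiv_add (hξ.differentiableAt_chartCo x) (hη.differentiableAt_chartCo x)]
    rfl
  have key : ∀ (a b : E →L[ℝ] E →L[ℝ] ℝ) (v w : E), (a + b - (a + b).flip) v w =
      (a - a.flip) v w + (b - b.flip) v w := by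
    intro a b v w
    simp only [sub_apply, add_apply, ContinuousLinearMap.flip_apply]
    ring
  unfold dCo
  rw [h]
  ext w
  exact key _ _ _ _

theorem courant_add_left [CompleteSpace E] {u u' v : ∀ x : M, GenT E x} (hu : SmoothGen u)
    (hu' : SmoothGen u') (hv : SmoothGen v) (x : M) :
    courant (fun y ↦ u y + u' y) v x = courant u v x + courant u' v x := by
  refine Prod.ext ?_ ?_
  · have : IsManifold 𝓘(ℝ, E) 2 M := IsManifold.of_le (n := ∞) (WithTop.coe_le_coe (b := (2 : ℕ∞)).2 le_top)
    exact VectorField.mlieBracket_add_left (hu.1.mdifferentiableAt x) (hu'.1.mdifferentiableAt x)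
  · have h : (fun y ↦ (v y).2 ((u y).1 + (u' y).1) - ((u y).2 + (u' y).2) (v y).1) =
        (fun y ↦ (v y).2 (u y).1 - (u y).2 (v y).1) +
        (fun y ↦ (v y).2 (u' y).1 - (u' y).2 (v y).1) := by
      ext y; simp only [Pi.add_apply, map_add, add_apply]; ring
    have d : ∀ w : ∀ x : M, GenT E x, SmoothGen w → MDifferentiableAt 𝓘(ℝ, E) 𝓘(ℝ, ℝ)
        (fun y ↦ (v y).2 (w y).1 - (w y).2 (v y).1) x := fun w hw ↦
      (((hv.2.pair hw.1).sub (hw.2.pair hv.1)) x).mdifferentiableAt (by simp)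
    have d2 := dCo_add hu.2 hu'.2 x (v x).1
    simp only [courant, Prod.snd_add, Prod.fst_add]
    rw [h, mvfderiv_add (d u hu) (d u' hu'), d2]
    have lin : dCo (fun y ↦ (v y).2) x ((u x).1 + (u' x).1) =
        dCo (fun y ↦ (v y).2) x (u x).1 + dCo (fun y ↦ (v y).2) x (u' x).1 := by
      have hl : ∀ (a : E →L[ℝ] E →L[ℝ] ℝ) (D : E →L[ℝ] E) (p q : E),
          (a (D (p + q))).comp D = (a (D p)).comp D + (a (D q)).comp D := by
        intro a D p q
        simp only [map_add, ContinuousLinearMap.add_comp]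
      exact hl _ _ _ _
    rw [lin, smul_add]
    abel

/-- The failure of `⟨[a, b], c⟩` to be cyclic. -/
theorem pairing_courant_cyclic {a b c : ∀ x : M, GenT E x} (ha : SmoothGen a) (hb : SmoothGen b)
    (hc : SmoothGen c) (x : M) :
    pairing (courant a b x) (c x) - pairing (courant b c x) (a x) =
      (1 / 2 : ℝ) * mvfderiv 𝓘(ℝ, E) (fun y ↦ pairing (b y) (c y)) x (a x).1 +
      (1 / 2 : ℝ) * mvfderiv 𝓘(ℝ, E) (fun y ↦ pairing (a y) (b y)) x (c x).1 -
      mvfderiv 𝓘(ℝ, E) (fun y ↦ pairing (a y) (c y)) x (b x).1 := by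
  have d : ∀ u w : ∀ x : M, GenT E x, SmoothGen u → SmoothGen w →
      MDifferentiableAt 𝓘(ℝ, E) 𝓘(ℝ, ℝ) (fun y ↦ (u y).2 (w y).1) x := fun u w hu hw ↦
    ((hu.2.pair hw.1) x).mdifferentiableAt (by simp)
  have dp : ∀ u w : ∀ x : M, GenT E x, SmoothGen u → SmoothGen w → ∀ v : TS E x,
      mvfderiv 𝓘(ℝ, E) (fun y ↦ pairing (u y) (w y)) x v =
      (1 / 2 : ℝ) * (mvfderiv 𝓘(ℝ, E) (fun y ↦ (u y).2 (w y).1) x v +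
        mvfderiv 𝓘(ℝ, E) (fun y ↦ (w y).2 (u y).1) x v) := by
    intro u w hu hw v
    have h : (fun y ↦ pairing (u y) (w y)) =
        (fun _ : M ↦ (1 / 2 : ℝ)) * ((fun y ↦ (u y).2 (w y).1) + fun y ↦ (w y).2 (u y).1) := rfl
    rw [h, mvfderiv_mul mdifferentiableAt_const ((d u w hu hw).add (d w u hw hu)),
      mvfderiv_add (d u w hu hw) (d w u hw hu), mvfderiv_const]
    simp only [add_apply, smul_apply, smul_eq_mul, smul_zero, add_zero]
  have ds : ∀ u w : ∀ x : M, GenT E x, SmoothGen u → SmoothGen w → ∀ v : TS E x,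
      mvfderiv 𝓘(ℝ, E) (fun y ↦ (w y).2 (u y).1 - (u y).2 (w y).1) x v =
      mvfderiv 𝓘(ℝ, E) (fun y ↦ (w y).2 (u y).1) x v -
        mvfderiv 𝓘(ℝ, E) (fun y ↦ (u y).2 (w y).1) x v := by
    intro u w hu hw v
    rw [mvfderiv_fun_sub (d w u hw hu) (d u w hu hw)]
    rfl
  have key : ∀ u w z : ∀ x : M, GenT E x, SmoothGen u → SmoothGen w → SmoothGen z →
      pairing (courant u w x) (z x) = (1 / 2 : ℝ) * (
        dCo (fun y ↦ (w y).2) x (u x).1 (z x).1 - dCo (fun y ↦ (u y).2) x (w x).1 (z x).1 +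
        (1 / 2 : ℝ) * (mvfderiv 𝓘(ℝ, E) (fun y ↦ (w y).2 (u y).1) x (z x).1 -
        mvfderiv 𝓘(ℝ, E) (fun y ↦ (u y).2 (w y).1) x (z x).1) +
        (z x).2 (VectorField.mlieBracket 𝓘(ℝ, E) (fun y ↦ (u y).1) (fun y ↦ (w y).1) x)) := by
    intro u w z hu hw hz
    rw [← ds u w hu hw]
    rfl
  -- Cartan's formula reduces both sides to derivatives of pairings and to Lie brackets; after
  -- antisymmetry the brackets cancel.
  rw [key a b c ha hb hc, key b c a hb hc ha, dp b c hb hc, dp a b ha hb, dp a c ha hc,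
    dCo_apply hb.2 ha.1 hc.1, dCo_apply ha.2 hb.1 hc.1, dCo_apply hc.2 hb.1 ha.1,
    dCo_apply hb.2 hc.1 ha.1]
  rw [VectorField.mlieBracket_swap_apply (V := fun y ↦ (b y).1) (W := fun y ↦ (a y).1),
    VectorField.mlieBracket_swap_apply (V := fun y ↦ (c y).1) (W := fun y ↦ (a y).1)]
  simp only [map_neg]
  ring

/-- The Nijenhuis expression of an endomorphism of `TM ⊕ T*M` for the Courant bracket. -/
def genNijenhuis (𝒥 : ∀ x : M, GenT E x →L[ℝ] GenT E x) (a b : ∀ x : M, GenT E x) (x : M) :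
    GenT E x :=
  courant a b x - courant (fun y ↦ 𝒥 y (a y)) (fun y ↦ 𝒥 y (b y)) x +
    𝒥 x (courant (fun y ↦ 𝒥 y (a y)) b x + courant a (fun y ↦ 𝒥 y (b y)) x)

omit [IsManifold 𝓘(ℝ, E) ∞ M] in
theorem genNijenhuis_swap (𝒥 : ∀ x : M, GenT E x →L[ℝ] GenT E x) (a b : ∀ x : M, GenT E x) (x : M) :
    genNijenhuis 𝒥 a b x = -genNijenhuis 𝒥 b a x := by
  unfold genNijenhuis
  rw [courant_swap a b, courant_swap (fun y ↦ 𝒥 y (a y)), courant_swap (fun y ↦ 𝒥 y (a y)) b,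
    courant_swap a (fun y ↦ 𝒥 y (b y))]
  simp only [gen_map_add, gen_map_neg]
  abel

theorem genNijenhuis_add_left [CompleteSpace E] {𝒥 : ∀ x : M, GenT E x →L[ℝ] GenT E x}
    (h𝒥 : SmoothGenEnd 𝒥) {a a' b : ∀ x : M, GenT E x} (ha : SmoothGen a) (ha' : SmoothGen a')
    (hb : SmoothGen b) (x : M) :
    genNijenhuis 𝒥 (fun y ↦ a y + a' y) b x = genNijenhuis 𝒥 a b x + genNijenhuis 𝒥 a' b x := by
  unfold genNijenhuis
  simp only [gen_map_add]
  rw [courant_add_left ha ha' hb, courant_add_left (h𝒥.apply ha) (h𝒥.apply ha') (h𝒥.apply hb),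
    courant_add_left (h𝒥.apply ha) (h𝒥.apply ha') hb, courant_add_left ha ha' (h𝒥.apply hb)]
  simp only [gen_map_add]
  abel

theorem genNijenhuis_add_right [CompleteSpace E] {𝒥 : ∀ x : M, GenT E x →L[ℝ] GenT E x}
    (h𝒥 : SmoothGenEnd 𝒥) {a b b' : ∀ x : M, GenT E x} (ha : SmoothGen a) (hb : SmoothGen b)
    (hb' : SmoothGen b') (x : M) :
    genNijenhuis 𝒥 a (fun y ↦ b y + b' y) x = genNijenhuis 𝒥 a b x + genNijenhuis 𝒥 a b' x := by
  rw [genNijenhuis_swap, genNijenhuis_add_left h𝒥 hb hb' ha, genNijenhuis_swap 𝒥 b,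
    genNijenhuis_swap 𝒥 b']
  abel

theorem IsAlmostGC.skew {𝒥 : ∀ x : M, GenT E x →L[ℝ] GenT E x} (h𝒥 : IsAlmostGC 𝒥) (x : M)
    (u v : GenT E x) : pairing (𝒥 x u) v = -pairing u (𝒥 x v) := by
  rw [← h𝒥.orth x u, h𝒥.sq, pairing_neg_right, neg_neg]

/-- The sections of the +i-eigenbundle are exactly 𝒥b + ib with b real. For two of them the
condition 𝒥(imaginary part) = real part on the bracket is N(b, d) = 0, and the other condition
follows by applying 𝒥. -/
theorem integrableGC_iff {𝒥 : ∀ x : M, GenT E x →L[ℝ] GenT E x} (h𝒥 : IsAlmostGC 𝒥) :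
    IntegrableGC 𝒥 ↔ ∀ a b : ∀ x : M, GenT E x, SmoothGen a → SmoothGen b →
      ∀ x, genNijenhuis 𝒥 a b x = 0 := by
  constructor
  · intro h a b ha hb x
    have := (h (fun y ↦ 𝒥 y (a y)) a (fun y ↦ 𝒥 y (b y)) b (h𝒥.smooth.apply ha) ha
      (h𝒥.smooth.apply hb) hb (fun x ↦ ⟨h𝒥.sq x _, rfl⟩) (fun x ↦ ⟨h𝒥.sq x _, rfl⟩) x).2
    rw [add_comm] at this
    unfold genNijenhuis
    rw [add_comm (courant (fun y ↦ 𝒥 y (a y)) b x), this]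
    abel
  · intro h a b c d ha hb hc hd hab hcd x
    obtain rfl : a = fun y ↦ 𝒥 y (b y) := funext fun y ↦ (hab y).2.symm
    obtain rfl : c = fun y ↦ 𝒥 y (d y) := funext fun y ↦ (hcd y).2.symm
    have h1 := h b d hb hd x
    unfold genNijenhuis at h1
    have h2 : 𝒥 x (courant (fun y ↦ 𝒥 y (b y)) d x + courant b (fun y ↦ 𝒥 y (d y)) x) =
        courant (fun y ↦ 𝒥 y (b y)) (fun y ↦ 𝒥 y (d y)) x - courant b d x := by
      rw [← sub_eq_zero, ← h1]; abel
    refine ⟨?_, h2⟩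
    rw [← h2, h𝒥.sq]

/-- The trilinear form `⟨N(a, b), c⟩` is cyclic. -/
theorem pairing_genNijenhuis_cyclic {𝒥 : ∀ x : M, GenT E x →L[ℝ] GenT E x} (h𝒥 : IsAlmostGC 𝒥)
    {a b c : ∀ x : M, GenT E x} (ha : SmoothGen a) (hb : SmoothGen b) (hc : SmoothGen c) (x : M) :
    pairing (genNijenhuis 𝒥 a b x) (c x) = pairing (genNijenhuis 𝒥 b c x) (a x) := by
  have ha' := h𝒥.smooth.apply ha
  have hb' := h𝒥.smooth.apply hb
  have hc' := h𝒥.smooth.apply hc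
  -- By skewness of 𝒥, the difference of the two sides is e1 - e2 - e3 - e4. Orthogonality and
  -- skewness of 𝒥 make the derivative terms of e2 + e3 + e4 add up to those of e1.
  have e1 := pairing_courant_cyclic ha hb hc x
  have e2 := pairing_courant_cyclic ha' hb' hc x
  have e3 := pairing_courant_cyclic ha' hb hc' x
  have e4 := pairing_courant_cyclic ha hb' hc' x
  have o : ∀ u v : ∀ x : M, GenT E x, (fun y ↦ pairing (𝒥 y (u y)) (𝒥 y (v y))) =
      fun y ↦ pairing (u y) (v y) := fun u v ↦ funext fun y ↦ h𝒥.orth y _ _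
  have s : ∀ u v : ∀ x : M, GenT E x, ∀ w : TS E x,
      mvfderiv 𝓘(ℝ, E) (fun y ↦ pairing (𝒥 y (u y)) (v y)) x w =
      -mvfderiv 𝓘(ℝ, E) (fun y ↦ pairing (u y) (𝒥 y (v y))) x w := by
    intro u v w
    have : (fun y ↦ pairing (𝒥 y (u y)) (v y)) = -fun y ↦ pairing (u y) (𝒥 y (v y)) :=
      funext fun y ↦ h𝒥.skew y _ _
    rw [this, mvfderiv_neg]
    rfl
  rw [o a b, s b c, s a c] at e2
  rw [o a c, s a b] at e3
  rw [o b c] at e4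
  unfold genNijenhuis
  rw [pairing_add_left, pairing_sub_left, h𝒥.skew, pairing_add_left, pairing_add_left,
    pairing_sub_left, h𝒥.skew, pairing_add_left]
  linarith

end Courant


/-! ### Invertibility from injectivity in finite dimension. -/

section Invertibility

variable {E : Type*} [NormedAddCommGroup E] [NormedSpace ℝ E] [FiniteDimensional ℝ E]

theorem isInvertible_bil_of_injective (B : E →L[ℝ] E →L[ℝ] ℝ) (hB : ∀ v, B v = 0 → v = 0) :
    B.IsInvertible := by
  have hr : Module.finrank ℝ E = Module.finrank ℝ (E →L[ℝ] ℝ) := by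
    rw [← Subspace.dual_finrank_eq (K := ℝ) (V := E)]
    exact (LinearMap.toContinuousLinearMap (𝕜 := ℝ) (E := E) (F' := ℝ)).finrank_eq
  have hi : Function.Injective (B : E →ₗ[ℝ] E →L[ℝ] ℝ) :=
    (injective_iff_map_eq_zero _).2 hB
  refine ⟨(LinearMap.linearEquivOfInjective (B : E →ₗ[ℝ] E →L[ℝ] ℝ) hi hr).toContinuousLinearEquiv, ?_⟩
  ext v w
  rfl

theorem isInvertible_end_of_injective (A : E →L[ℝ] E) (hA : ∀ v, A v = 0 → v = 0) :
    A.IsInvertible := by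
  have hi : Function.Injective (A : E →ₗ[ℝ] E) := (injective_iff_map_eq_zero _).2 hA
  refine ⟨(LinearMap.linearEquivOfInjective (A : E →ₗ[ℝ] E) hi rfl).toContinuousLinearEquiv, ?_⟩
  ext v
  rfl

end Invertibility

/-! ### Fibrewise inverses and block matrices. -/

section Pointwise

variable {E : Type*} [NormedAddCommGroup E] [NormedSpace ℝ E] [FiniteDimensional ℝ E]
  {M : Type*} [TopologicalSpace M] [ChartedSpace E M]

theorem isInvertible_tc {x : M} (B : TS E x →L[ℝ] CoT E x) (hB : ∀ v, B v = 0 → v = 0) :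
    B.IsInvertible := isInvertible_bil_of_injective (E := E) B hB

theorem isInvertible_tt {x : M} (A : TS E x →L[ℝ] TS E x) (hA : ∀ v, A v = 0 → v = 0) :
    A.IsInvertible := isInvertible_end_of_injective (E := E) A hA

omit [FiniteDimensional ℝ E]

theorem inverse_tc_apply {x : M} {B : TS E x →L[ℝ] CoT E x} (hB : B.IsInvertible) (v : TS E x) :
    B.inverse (B v) = v := by
  obtain ⟨e, rfl⟩ := hB
  simp

theorem apply_inverse_tc {x : M} {B : TS E x →L[ℝ] CoT E x} (hB : B.IsInvertible) (ξ : CoT E x) :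
    B (B.inverse ξ) = ξ := by
  obtain ⟨e, rfl⟩ := hB
  simp

theorem apply_inverse_tt {x : M} {B : TS E x →L[ℝ] TS E x} (hB : B.IsInvertible) (v : TS E x) :
    B (B.inverse v) = v := by
  obtain ⟨e, rfl⟩ := hB
  simp

theorem blocks_apply {x : M} (A : TS E x →L[ℝ] TS E x) (β : CoT E x →L[ℝ] TS E x)
    (B : TS E x →L[ℝ] CoT E x) (D : CoT E x →L[ℝ] CoT E x) (v : TS E x) (ξ : CoT E x) :
    blocks A β B D (v, ξ) = (A v + β ξ, B v + D ξ) := rfl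

theorem shear_apply {x : M} (B : TS E x →L[ℝ] CoT E x) (v : TS E x) (ξ : CoT E x) :
    shear B (v, ξ) = (v, B v + ξ) :=
  Prod.ext (add_zero v) rfl

end Pointwise

/-! ### Smoothness of block endomorphisms of TM ⊕ T*M. -/

section SmoothBlocks

variable {E : Type*} [NormedAddCommGroup E] [NormedSpace ℝ E]
  {M : Type*} [TopologicalSpace M] [ChartedSpace E M] [IsManifold 𝓘(ℝ, E) ∞ M]

theorem smoothGenEnd_blocks {A : ∀ x : M, TS E x →L[ℝ] TS E x} {β : ∀ x : M, CoT E x →L[ℝ] TS E x}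
    {B : ∀ x : M, TS E x →L[ℝ] CoT E x} {D : ∀ x : M, CoT E x →L[ℝ] CoT E x}
    (hA : SmoothTT A) (hβ : SmoothCT β) (hB : SmoothTC B) (hD : SmoothCC D) :
    SmoothGenEnd (fun x ↦ blocks (A x) (β x) (B x) (D x)) := by
  refine ⟨?_, ?_, ?_, ?_⟩
  · convert hA using 2 with x
    ext v
    exact (congrArg (A x v + ·) (β x).toLinearMap.map_zero).trans (add_zero _)
  · convert hβ using 2 with x
    ext v
    exact (congrArg (· + β x v) (A x).toLinearMap.map_zero).trans (zero_add _)
  · convert hB using 2 with x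
    ext v : 1
    exact (congrArg (B x v + ·) (D x).toLinearMap.map_zero).trans (add_zero _)
  · convert hD using 2 with x
    ext v : 1
    exact (congrArg (· + D x v) (B x).toLinearMap.map_zero).trans (zero_add _)

theorem SmoothCC.comp (D D' : ∀ x : M, CoT E x →L[ℝ] CoT E x) (h : SmoothCC D) (h' : SmoothCC D') :
    SmoothCC (fun x ↦ (D x).comp (D' x)) :=
  contMDiff_clm_bundle_comp h h'

theorem SmoothCC.add {D D' : ∀ x : M, CoT E x →L[ℝ] CoT E x} (h : SmoothCC D) (h' : SmoothCC D') :
    SmoothCC (fun x ↦ D x + D' x) :=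
  ContMDiff.add_section h h'

theorem SmoothCC.smul {D : ∀ x : M, CoT E x →L[ℝ] CoT E x} (c : ℝ) (h : SmoothCC D) :
    SmoothCC (fun x ↦ c • D x) :=
  ContMDiff.const_smul_section h

theorem SmoothCT.comp_cc {β : ∀ x : M, CoT E x →L[ℝ] TS E x} {D : ∀ x : M, CoT E x →L[ℝ] CoT E x}
    (h : SmoothCT β) (h' : SmoothCC D) : SmoothCT (fun x ↦ (β x).comp (D x)) :=
  contMDiff_clm_bundle_comp h h'

theorem smoothCC_id : SmoothCC (fun x : M ↦ ContinuousLinearMap.id ℝ (CoT E x)) :=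
  SmoothTT.dualEnd smoothTT_id

theorem smoothCT_zero : SmoothCT (fun x : M ↦ (0 : CoT E x →L[ℝ] TS E x)) :=
  Bundle.contMDiff_zeroSection (F := (E →L[ℝ] ℝ) →L[ℝ] E) ℝ (fun x : M ↦ CoT E x →L[ℝ] TS E x)

theorem SmoothGenEnd.smul {𝒥 : ∀ x : M, GenT E x →L[ℝ] GenT E x} (c : ℝ) (h : SmoothGenEnd 𝒥) :
    SmoothGenEnd (fun x ↦ c • 𝒥 x) :=
  ⟨SmoothTT.smul c h.1, SmoothCT.smul c h.2.1, SmoothTC.smul c h.2.2.1, SmoothCC.smul c h.2.2.2⟩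

theorem SmoothGenEnd.comp {𝒥 𝒦 : ∀ x : M, GenT E x →L[ℝ] GenT E x} (h : SmoothGenEnd 𝒥)
    (k : SmoothGenEnd 𝒦) : SmoothGenEnd (fun x ↦ (𝒥 x).comp (𝒦 x)) := by
  have key : ∀ x (u : GenT E x), 𝒥 x (𝒦 x u) = 𝒥 x ((𝒦 x u).1, 0) + 𝒥 x (0, (𝒦 x u).2) := by
    intro x u
    rw [← gen_map_add]
    simp
  refine ⟨?_, ?_, ?_, ?_⟩
  · convert (h.1.comp k.1).add (h.2.1.comp_tc k.2.2.1) using 2 with x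
    ext v
    exact congrArg Prod.fst (key x (v, 0))
  · convert (h.1.comp_ct k.2.1).add (h.2.1.comp_cc k.2.2.2) using 2 with x
    ext v
    exact congrArg Prod.fst (key x (0, v))
  · convert (h.2.2.1.comp_tt k.1).add (h.2.2.2.comp_tc k.2.2.1) using 2 with x
    ext v : 1
    exact congrArg Prod.snd (key x (v, 0))
  · convert (h.2.2.1.comp_ct k.2.1).add (SmoothCC.comp _ _ h.2.2.2 k.2.2.2) using 2 with x
    ext v : 1
    exact congrArg Prod.snd (key x (0, v))

theorem smoothGenEnd_shear {B : ∀ x : M, TS E x →L[ℝ] CoT E x} (hB : SmoothTC B) :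
    SmoothGenEnd (fun x ↦ shear (B x)) :=
  smoothGenEnd_blocks smoothTT_id smoothCT_zero hB smoothCC_id

end SmoothBlocks


/-! ### From almost bihermitian data to almost generalized Kähler pairs. -/

section Hermitian

variable {E : Type*} [NormedAddCommGroup E] [NormedSpace ℝ E]
  {M : Type*} [TopologicalSpace M] [ChartedSpace E M]

/-- The embedding `v ↦ v + (g - b) v` of `TM` onto the `+1`-eigenbundle of `𝒢`. -/
def Quadruple.plus (q : Quadruple E M) (x : M) (v : TS E x) : GenT E x :=
  (v, q.g x v - q.b x v)

/-- The embedding `v ↦ v - (g + b) v` of `TM` onto the `-1`-eigenbundle of `𝒢`. -/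
def Quadruple.minus (q : Quadruple E M) (x : M) (v : TS E x) : GenT E x :=
  (v, -q.g x v - q.b x v)

theorem Quadruple.plus_neg (q : Quadruple E M) (x : M) (v : TS E x) :
    q.plus x (-v) = -q.plus x v := by
  refine Prod.ext rfl ?_
  simp only [plus, map_neg, Prod.snd_neg]
  abel

theorem Quadruple.minus_neg (q : Quadruple E M) (x : M) (v : TS E x) :
    q.minus x (-v) = -q.minus x v := by
  refine Prod.ext rfl ?_
  simp only [minus, map_neg, Prod.snd_neg]
  abel

variable [IsManifold 𝓘(ℝ, E) ∞ M]

theorem IsAlmostComplex.eq_zero {J : ∀ x : M, TS E x →L[ℝ] TS E x} (hJ : IsAlmostComplex J) (x : M) (v : TS E x)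
    (h : J x v = 0) : v = 0 := by
  have := hJ.sq x v
  rw [h, map_zero] at this
  exact (neg_eq_zero.1 this.symm)

variable {q : Quadruple E M} (hq : q.IsAlmostBihermitian)
include hq

theorem Quadruple.IsAlmostBihermitian.b_skew (x : M) (v w : TS E x) : q.b x v w = -q.b x w v := by
  have h := hq.b_alt x (v + w)
  simp only [map_add, add_apply, hq.b_alt] at h
  linarith

theorem Quadruple.IsAlmostBihermitian.g_Jp (x : M) (v w : TS E x) :
    q.g x v (q.Jp x w) = -q.g x (q.Jp x v) w := by
  rw [← hq.Jp_herm, hq.Jp_ac.sq, map_neg]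

theorem Quadruple.IsAlmostBihermitian.g_Jm (x : M) (v w : TS E x) :
    q.g x v (q.Jm x w) = -q.g x (q.Jm x v) w := by
  rw [← hq.Jm_herm, hq.Jm_ac.sq, map_neg]

theorem Quadruple.IsAlmostBihermitian.g_inj (x : M) (v : TS E x) (h : q.g x v = 0) : v = 0 := by
  by_contra hv
  have := hq.g_pos x v hv
  rw [h] at this
  exact lt_irrefl _ this

theorem Quadruple.IsAlmostBihermitian.pairing_plus_plus (x : M) (v w : TS E x) :
    pairing (q.plus x v) (q.plus x w) = q.g x v w := by
  simp only [pairing, plus, sub_apply]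
  rw [hq.g_symm x w v, hq.b_skew x w v]
  ring

theorem Quadruple.IsAlmostBihermitian.pairing_minus_minus (x : M) (v w : TS E x) :
    pairing (q.minus x v) (q.minus x w) = -q.g x v w := by
  simp only [pairing, minus, sub_apply, neg_apply]
  rw [hq.g_symm x w v, hq.b_skew x w v]
  ring

theorem Quadruple.IsAlmostBihermitian.pairing_plus_minus (x : M) (v w : TS E x) :
    pairing (q.plus x v) (q.minus x w) = 0 := by
  simp only [pairing, plus, minus, sub_apply, neg_apply]
  rw [hq.g_symm x w v, hq.b_skew x w v]
  ring

theorem Quadruple.IsAlmostBihermitian.pairing_minus_plus (x : M) (v w : TS E x) :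
    pairing (q.minus x v) (q.plus x w) = 0 := by
  rw [pairing_comm, hq.pairing_plus_minus]

variable [FiniteDimensional ℝ E]

theorem Quadruple.IsAlmostBihermitian.g_inv (x : M) : (q.g x).IsInvertible :=
  isInvertible_tc _ (hq.g_inj x)

theorem Quadruple.IsAlmostBihermitian.ωp_inv (x : M) : (q.ωp x).IsInvertible :=
  isInvertible_tc _ fun v hv ↦ hq.Jp_ac.eq_zero x v (hq.g_inj x _ hv)

theorem Quadruple.IsAlmostBihermitian.ωm_inv (x : M) : (q.ωm x).IsInvertible :=
  isInvertible_tc _ fun v hv ↦ hq.Jm_ac.eq_zero x v (hq.g_inj x _ hv)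

theorem Quadruple.IsAlmostBihermitian.ωp_inverse_g (x : M) (v : TS E x) :
    (q.ωp x).inverse (q.g x v) = -q.Jp x v := by
  have h : q.ωp x (-q.Jp x v) = q.g x v := by
    rw [map_neg]
    change -q.g x (q.Jp x (q.Jp x v)) = _
    rw [hq.Jp_ac.sq, map_neg, neg_neg]
  rw [← h, inverse_tc_apply (hq.ωp_inv x)]

theorem Quadruple.IsAlmostBihermitian.ωm_inverse_g (x : M) (v : TS E x) :
    (q.ωm x).inverse (q.g x v) = -q.Jm x v := by
  have h : q.ωm x (-q.Jm x v) = q.g x v := by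
    rw [map_neg]
    change -q.g x (q.Jm x (q.Jm x v)) = _
    rw [hq.Jm_ac.sq, map_neg, neg_neg]
  rw [← h, inverse_tc_apply (hq.ωm_inv x)]

theorem Quadruple.IsAlmostBihermitian.ωp_inverse_neg_g (x : M) (v : TS E x) :
    (q.ωp x).inverse (-q.g x v) = q.Jp x v := by
  have h : q.ωp x (q.Jp x v) = -q.g x v := by
    change q.g x (q.Jp x (q.Jp x v)) = _
    rw [hq.Jp_ac.sq, map_neg]
  rw [← h, inverse_tc_apply (hq.ωp_inv x)]

theorem Quadruple.IsAlmostBihermitian.ωm_inverse_neg_g (x : M) (v : TS E x) :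
    (q.ωm x).inverse (-q.g x v) = q.Jm x v := by
  have h : q.ωm x (q.Jm x v) = -q.g x v := by
    change q.g x (q.Jm x (q.Jm x v)) = _
    rw [hq.Jm_ac.sq, map_neg]
  rw [← h, inverse_tc_apply (hq.ωm_inv x)]

section

omit [FiniteDimensional ℝ E]

theorem Quadruple.IsAlmostBihermitian.dualEnd_Jp (x : M) (v : TS E x) :
    dualEnd q.Jp x (q.g x v) = -q.g x (q.Jp x v) := by
  ext w
  exact hq.g_Jp x v w

theorem Quadruple.IsAlmostBihermitian.dualEnd_Jm (x : M) (v : TS E x) :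
    dualEnd q.Jm x (q.g x v) = -q.g x (q.Jm x v) := by
  ext w
  exact hq.g_Jm x v w

theorem Quadruple.IsAlmostBihermitian.dualEnd_Jp_neg (x : M) (v : TS E x) :
    dualEnd q.Jp x (-q.g x v) = q.g x (q.Jp x v) := by
  ext w
  exact neg_eq_iff_eq_neg.2 (hq.g_Jp x v w)

theorem Quadruple.IsAlmostBihermitian.dualEnd_Jm_neg (x : M) (v : TS E x) :
    dualEnd q.Jm x (-q.g x v) = q.g x (q.Jm x v) := by
  ext w
  exact neg_eq_iff_eq_neg.2 (hq.g_Jm x v w)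

omit hq [IsManifold 𝓘(ℝ, E) ∞ M]

/-- The right shear removes b from the argument and the left one restores it, so `gen₁` and `gen₂`
can be evaluated on both eigenbundles as if b = 0, taking ξ = ±gv. -/
theorem Quadruple.sheared_apply (q : Quadruple E M) {x : M} (A : TS E x →L[ℝ] TS E x)
    (β : CoT E x →L[ℝ] TS E x) (B : TS E x →L[ℝ] CoT E x) (D : CoT E x →L[ℝ] CoT E x)
    (v : TS E x) (ξ : CoT E x) {w : TS E x} {η : CoT E x} (hw : A v + β ξ = (2 : ℝ) • w)
    (hη : B v + D ξ = (2 : ℝ) • η) :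
    ((1 / 2 : ℝ) • (shear (-q.b x)).comp ((blocks A β B D).comp (shear (q.b x)))) (v, ξ - q.b x v) =
      (w, η - q.b x w) := by
  have h : shear (q.b x) (v, ξ - q.b x v) = (v, ξ) := by rw [shear_apply, add_sub_cancel]
  change (1 / 2 : ℝ) • shear (-q.b x) (blocks A β B D (shear (q.b x) (v, ξ - q.b x v))) = _
  rw [h, blocks_apply, hw, hη, shear_apply, neg_apply, map_smul]
  refine Prod.ext ?_ ?_
  · change (1 / 2 : ℝ) • (2 : ℝ) • w = w
    rw [smul_smul]
    norm_num
  · change (1 / 2 : ℝ) • (-((2 : ℝ) • q.b x w) + (2 : ℝ) • η) = η - q.b x w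
    module

end

/-- On the covector gv both ω±⁻¹ and the dual maps turn into J±, up to sign: the J₋ terms cancel and
the J₊ terms double, which absorbs the factor ½. -/
theorem Quadruple.IsAlmostBihermitian.gen₁_plus (x : M) (v : TS E x) :
    q.gen₁ x (q.plus x v) = q.plus x (q.Jp x v) := by
  refine q.sheared_apply _ _ _ _ v (q.g x v) ?_ ?_
  · simp only [sub_apply, neg_apply, add_apply, hq.ωm_inverse_g, hq.ωp_inverse_g, two_smul]
    abel
  · simp only [sub_apply, neg_apply, add_apply, hq.dualEnd_Jp, hq.dualEnd_Jm, two_smul, ωm, ωp,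
      ContinuousLinearMap.comp_apply]
    abel

theorem Quadruple.IsAlmostBihermitian.gen₁_minus (x : M) (v : TS E x) :
    q.gen₁ x (q.minus x v) = q.minus x (-q.Jm x v) := by
  refine q.sheared_apply _ _ _ _ v (-q.g x v) ?_ ?_
  · simp only [sub_apply, neg_apply, add_apply, hq.ωm_inverse_neg_g, hq.ωp_inverse_neg_g, two_smul]
    abel
  · simp only [sub_apply, neg_apply, add_apply, hq.dualEnd_Jp_neg, hq.dualEnd_Jm_neg, two_smul, ωm,
      ωp, ContinuousLinearMap.comp_apply, (q.g x).map_neg, neg_neg]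
    abel

theorem Quadruple.IsAlmostBihermitian.gen₂_plus (x : M) (v : TS E x) :
    q.gen₂ x (q.plus x v) = q.plus x (q.Jp x v) := by
  refine q.sheared_apply _ _ _ _ v (q.g x v) ?_ ?_
  · simp only [sub_apply, add_apply, hq.ωm_inverse_g, hq.ωp_inverse_g, two_smul]
    abel
  · simp only [sub_apply, neg_apply, add_apply, hq.dualEnd_Jp, hq.dualEnd_Jm, two_smul, ωm, ωp,
      ContinuousLinearMap.comp_apply]
    abel

theorem Quadruple.IsAlmostBihermitian.gen₂_minus (x : M) (v : TS E x) :
    q.gen₂ x (q.minus x v) = q.minus x (q.Jm x v) := by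
  refine q.sheared_apply _ _ _ _ v (-q.g x v) ?_ ?_
  · simp only [sub_apply, add_apply, hq.ωm_inverse_neg_g, hq.ωp_inverse_neg_g, two_smul]
    abel
  · simp only [sub_apply, neg_apply, add_apply, hq.dualEnd_Jp_neg, hq.dualEnd_Jm_neg, two_smul, ωm,
      ωp, ContinuousLinearMap.comp_apply]
    abel

/-- The two eigenbundles of `𝒢` span `TM ⊕ T*M`. -/
theorem Quadruple.IsAlmostBihermitian.eq_plus_add_minus (x : M) (u : GenT E x) :
    u = q.plus x ((1 / 2 : ℝ) • (u.1 + (q.g x).inverse (u.2 + q.b x u.1))) +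
      q.minus x ((1 / 2 : ℝ) • (u.1 - (q.g x).inverse (u.2 + q.b x u.1))) := by
  -- The two components require v + w = u.1 and g(v - w) = u.2 + b(u.1); `z` is v - w.
  set z := (q.g x).inverse (u.2 + q.b x u.1) with hz
  have h : q.g x z = u.2 + q.b x u.1 := apply_inverse_tc (hq.g_inv x) _
  refine Prod.ext ?_ ?_
  · simp only [plus, minus, Prod.fst_add, smul_add, smul_sub]
    rw [add_add_sub_cancel, ← add_smul]
    norm_num
  · simp only [plus, minus, Prod.snd_add, map_smul, map_add, map_sub, h]
    module

theorem Quadruple.IsAlmostBihermitian.exists_decomposition (x : M) (u : GenT E x) :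
    ∃ v w, u = q.plus x v + q.minus x w :=
  ⟨_, _, hq.eq_plus_add_minus x u⟩

omit [FiniteDimensional ℝ E] in
theorem Quadruple.IsAlmostBihermitian.ωp_smooth : SmoothTC q.ωp :=
  hq.g_smooth.comp_tt hq.Jp_ac.smooth

omit [FiniteDimensional ℝ E] in
theorem Quadruple.IsAlmostBihermitian.ωm_smooth : SmoothTC q.ωm :=
  hq.g_smooth.comp_tt hq.Jm_ac.smooth

theorem Quadruple.IsAlmostBihermitian.gen₁_smooth : SmoothGenEnd q.gen₁ := by
  have := FiniteDimensional.complete ℝ E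
  exact SmoothGenEnd.smul (1 / 2) ((smoothGenEnd_shear hq.b_smooth.neg).comp
    ((smoothGenEnd_blocks (hq.Jp_ac.smooth.sub hq.Jm_ac.smooth)
      ((hq.ωm_smooth.inverse hq.ωm_inv).add (hq.ωp_smooth.inverse hq.ωp_inv)).neg
      (hq.ωm_smooth.add hq.ωp_smooth)
      (SmoothCC.neg (ContMDiff.sub_section hq.Jp_ac.smooth.dualEnd hq.Jm_ac.smooth.dualEnd))).comp
      (smoothGenEnd_shear hq.b_smooth)))

theorem Quadruple.IsAlmostBihermitian.gen₂_smooth : SmoothGenEnd q.gen₂ := by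
  have := FiniteDimensional.complete ℝ E
  exact SmoothGenEnd.smul (1 / 2) ((smoothGenEnd_shear hq.b_smooth.neg).comp
    ((smoothGenEnd_blocks (hq.Jm_ac.smooth.add hq.Jp_ac.smooth)
      ((hq.ωm_smooth.inverse hq.ωm_inv).sub (hq.ωp_smooth.inverse hq.ωp_inv))
      (hq.ωm_smooth.sub hq.ωp_smooth).neg
      (SmoothCC.neg (hq.Jm_ac.smooth.dualEnd.add hq.Jp_ac.smooth.dualEnd))).comp
      (smoothGenEnd_shear hq.b_smooth)))

omit [FiniteDimensional ℝ E] in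
theorem Quadruple.IsAlmostBihermitian.pairing_decomposed (x : M) (v w v' w' : TS E x) :
    pairing (q.plus x v + q.minus x w) (q.plus x v' + q.minus x w') =
      q.g x v v' - q.g x w w' := by
  rw [pairing_add_left, pairing_add_right, pairing_add_right, hq.pairing_plus_plus,
    hq.pairing_plus_minus, hq.pairing_minus_plus, hq.pairing_minus_minus]
  ring

theorem Quadruple.IsAlmostBihermitian.gen₁_decomposed (x : M) (v w : TS E x) :
    q.gen₁ x (q.plus x v + q.minus x w) =
      q.plus x (q.Jp x v) + q.minus x (-q.Jm x w) := by
  rw [gen_map_add, hq.gen₁_plus, hq.gen₁_minus]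

theorem Quadruple.IsAlmostBihermitian.gen₂_decomposed (x : M) (v w : TS E x) :
    q.gen₂ x (q.plus x v + q.minus x w) =
      q.plus x (q.Jp x v) + q.minus x (q.Jm x w) := by
  rw [gen_map_add, hq.gen₂_plus, hq.gen₂_minus]

omit hq [IsManifold 𝓘(ℝ, E) ∞ M] [FiniteDimensional ℝ E] in
theorem Quadruple.neg_decomposed (q : Quadruple E M) (x : M) (v w : TS E x) :
    -(q.plus x v + q.minus x w) = q.plus x (-v) + q.minus x (-w) := by
  rw [q.plus_neg, q.minus_neg, neg_add]

theorem Quadruple.IsAlmostBihermitian.isAlmostGC_gen₁ : IsAlmostGC q.gen₁ where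
  smooth := hq.gen₁_smooth
  sq x u := by
    obtain ⟨v, w, rfl⟩ := hq.exists_decomposition x u
    rw [hq.gen₁_decomposed, hq.gen₁_decomposed, q.neg_decomposed, hq.Jp_ac.sq, map_neg, neg_neg,
      hq.Jm_ac.sq]
  orth x u u' := by
    obtain ⟨v, w, rfl⟩ := hq.exists_decomposition x u
    obtain ⟨v', w', rfl⟩ := hq.exists_decomposition x u'
    rw [hq.gen₁_decomposed, hq.gen₁_decomposed, hq.pairing_decomposed, hq.pairing_decomposed,
      hq.Jp_herm, map_neg, map_neg, neg_apply, neg_neg, hq.Jm_herm]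

theorem Quadruple.IsAlmostBihermitian.isAlmostGC_gen₂ : IsAlmostGC q.gen₂ where
  smooth := hq.gen₂_smooth
  sq x u := by
    obtain ⟨v, w, rfl⟩ := hq.exists_decomposition x u
    rw [hq.gen₂_decomposed, hq.gen₂_decomposed, q.neg_decomposed, hq.Jp_ac.sq, hq.Jm_ac.sq]
  orth x u u' := by
    obtain ⟨v, w, rfl⟩ := hq.exists_decomposition x u
    obtain ⟨v', w', rfl⟩ := hq.exists_decomposition x u'
    rw [hq.gen₂_decomposed, hq.gen₂_decomposed, hq.pairing_decomposed, hq.pairing_decomposed,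
      hq.Jp_herm, hq.Jm_herm]

/-- This identifies the two graphs as the ±1-eigenbundles of 𝒢. The pairing is g on the first and -g
on the second, so ⟨𝒢u, u⟩ = g(v, v) + g(w, w). -/
theorem Quadruple.IsAlmostBihermitian.metric_decomposed (x : M) (v w : TS E x) :
    -q.gen₁ x (q.gen₂ x (q.plus x v + q.minus x w)) = q.plus x v + q.minus x (-w) := by
  rw [hq.gen₂_decomposed, hq.gen₁_decomposed, q.neg_decomposed, hq.Jp_ac.sq, hq.Jm_ac.sq]
  simp only [neg_neg]

/-- The pair determined by an almost bihermitian quadruple is almost generalized Kähler. -/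
theorem Quadruple.IsAlmostBihermitian.isAlmostGK : IsAlmostGK q.gen₁ q.gen₂ where
  fst := hq.isAlmostGC_gen₁
  snd := hq.isAlmostGC_gen₂
  comm x u := by
    obtain ⟨v, w, rfl⟩ := hq.exists_decomposition x u
    rw [hq.gen₂_decomposed, hq.gen₁_decomposed, hq.gen₁_decomposed, hq.gen₂_decomposed, map_neg]
  symm x u u' := by
    obtain ⟨v, w, rfl⟩ := hq.exists_decomposition x u
    obtain ⟨v', w', rfl⟩ := hq.exists_decomposition x u'
    rw [hq.metric_decomposed, hq.metric_decomposed, hq.pairing_decomposed, hq.pairing_decomposed,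
      map_neg, map_neg, neg_apply, neg_apply, hq.g_symm x v, hq.g_symm x w]
  pos x u hu := by
    obtain ⟨v, w, rfl⟩ := hq.exists_decomposition x u
    rw [hq.metric_decomposed, hq.pairing_decomposed, map_neg, neg_apply, sub_neg_eq_add]
    have hz : ∀ z : TS E x, 0 ≤ q.g x z z := fun z ↦ by
      rcases eq_or_ne z 0 with rfl | hz
      · rw [map_zero]
      · exact (hq.g_pos x z hz).le
    by_cases hv : v = 0
    · by_cases hw : w = 0
      · refine absurd ?_ hu
        rw [hv, hw]
        refine Prod.ext (add_zero _) ?_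
        simp only [plus, minus, map_zero, Prod.snd_add, Prod.snd_zero, sub_zero, neg_zero, add_zero]
      · exact add_pos_of_nonneg_of_pos (hz v) (hq.g_pos x w hw)
    · exact add_pos_of_pos_of_nonneg (hq.g_pos x v hv) (hz w)

end Hermitian


theorem eq_zero_of_eq_neg_self {E : Type*} [AddCommGroup E] [Module ℝ E] {v : E} (h : v = -v) :
    v = 0 := by
  have h2 : (2 : ℝ) • v = 0 := by
    rw [two_smul]
    nth_rewrite 2 [h]
    exact add_neg_cancel v
  exact (smul_eq_zero.1 h2).resolve_left two_ne_zero

/-! ### Tamed almost complex structures and pairs containing 𝒥_Ω. -/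

section Tamed

variable {E : Type*} [NormedAddCommGroup E] [NormedSpace ℝ E]
  {M : Type*} [TopologicalSpace M] [ChartedSpace E M] [IsManifold 𝓘(ℝ, E) ∞ M]
  {Ω : ∀ x : M, TS E x →L[ℝ] CoT E x} (hΩ : IsSymplectic Ω)

include hΩ

theorem IsSymplectic.skew (x : M) (v w : TS E x) : Ω x v w = -Ω x w v := by
  have h := hΩ.alt x (v + w)
  simp only [map_add, add_apply, hΩ.alt] at h
  linarith

theorem IsSymplectic.inj (x : M) {v w : TS E x} (h : Ω x v = Ω x w) : v = w := by
  refine sub_eq_zero.1 (hΩ.nondeg x _ fun z ↦ ?_)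
  rw [map_sub, h, sub_self, zero_apply]

variable [FiniteDimensional ℝ E]

theorem IsSymplectic.isInvertible (x : M) : (Ω x).IsInvertible :=
  isInvertible_tc _ fun v hv ↦ hΩ.nondeg x v fun w ↦ by rw [hv, zero_apply]

/-- Writing covectors as Ωw removes the inverse from later computations with 𝒥_Ω. -/
theorem IsSymplectic.genOmega_apply (x : M) (v w : TS E x) :
    genOmega Ω x (v, Ω x w) = (w, -Ω x v) := by
  refine (blocks_apply _ _ _ _ v (Ω x w)).trans ?_
  rw [inverse_tc_apply (hΩ.isInvertible x)]
  exact Prod.ext (zero_add w) (add_zero _)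

theorem IsSymplectic.genOmega_apply' (x : M) (u : GenT E x) :
    genOmega Ω x u = ((Ω x).inverse u.2, -Ω x u.1) := by
  have h := hΩ.genOmega_apply x u.1 ((Ω x).inverse u.2)
  rwa [apply_inverse_tc (hΩ.isInvertible x)] at h

theorem IsSymplectic.genOmega_sq (x : M) (u : GenT E x) : genOmega Ω x (genOmega Ω x u) = -u := by
  have h : genOmega Ω x ((Ω x).inverse u.2, Ω x (-u.1)) = (-u.1, -Ω x ((Ω x).inverse u.2)) :=
    hΩ.genOmega_apply x _ _
  rw [hΩ.genOmega_apply' x u, ← (Ω x).map_neg, h, apply_inverse_tc (hΩ.isInvertible x)]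
  rfl

/-- The bilinear form ΩJ₋ is the transpose of ΩJ. With nondegeneracy this characterizes J₋ without
Ω⁻¹, makes g = ½Ω(J + J₋) symmetric and b skew. -/
theorem IsSymplectic.minusConj_apply (J : ∀ x : M, TS E x →L[ℝ] TS E x) (x : M) (v w : TS E x) :
    Ω x (minusConj Ω J x v) w = Ω x (J x w) v := by
  have h : Ω x (minusConj Ω J x v) = -(dualEnd J x (Ω x v)) := by
    change Ω x (-((Ω x).inverse (dualEnd J x (Ω x v)))) = _
    rw [(Ω x).map_neg, apply_inverse_tc (hΩ.isInvertible x)]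
  rw [h, hΩ.skew x (J x w) v]
  rfl

theorem IsSymplectic.eq_minusConj {J K : ∀ x : M, TS E x →L[ℝ] TS E x}
    (h : ∀ (x : M) (v w : TS E x), Ω x (K x v) w = Ω x (J x w) v) : K = minusConj Ω J := by
  ext x v
  refine hΩ.inj x ?_
  ext w
  rw [h, hΩ.minusConj_apply]

theorem IsSymplectic.isAlmostComplex_minusConj {J : ∀ x : M, TS E x →L[ℝ] TS E x}
    (hJ : IsAlmostComplex J) : IsAlmostComplex (minusConj Ω J) where
  smooth := by
    have := FiniteDimensional.complete ℝ E
    exact ((hΩ.smooth.inverse hΩ.isInvertible).comp_tc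
      (SmoothCC.comp_tc hJ.smooth.dualEnd hΩ.smooth)).neg
  sq x v := by
    refine hΩ.inj x ?_
    ext w
    rw [hΩ.minusConj_apply, hΩ.skew, hΩ.minusConj_apply, hJ.sq, map_neg, map_neg, neg_apply,
      neg_apply, neg_neg, hΩ.skew]

omit hΩ [IsManifold 𝓘(ℝ, E) ∞ M] [FiniteDimensional ℝ E] in
theorem tamedQuadruple_plus (J : ∀ x : M, TS E x →L[ℝ] TS E x) (x : M) (v : TS E x) :
    (tamedQuadruple Ω J).plus x v = (v, Ω x (J x v)) := by
  refine Prod.ext rfl ?_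
  change (1 / 2 : ℝ) • Ω x (J x v + minusConj Ω J x v) -
    -((1 / 2 : ℝ) • Ω x (J x v - minusConj Ω J x v)) = _
  rw [map_add, map_sub]
  module

omit hΩ [IsManifold 𝓘(ℝ, E) ∞ M] [FiniteDimensional ℝ E] in
theorem tamedQuadruple_minus (J : ∀ x : M, TS E x →L[ℝ] TS E x) (x : M) (v : TS E x) :
    (tamedQuadruple Ω J).minus x v = (v, -Ω x (minusConj Ω J x v)) := by
  refine Prod.ext rfl ?_
  change -((1 / 2 : ℝ) • Ω x (J x v + minusConj Ω J x v)) -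
    -((1 / 2 : ℝ) • Ω x (J x v - minusConj Ω J x v)) = _
  rw [map_add, map_sub]
  module

theorem IsSymplectic.tamedQuadruple_g_apply (J : ∀ x : M, TS E x →L[ℝ] TS E x) (x : M)
    (v w : TS E x) :
    (tamedQuadruple Ω J).g x v w = (1 / 2 : ℝ) * (Ω x (J x v) w + Ω x (J x w) v) := by
  change (1 / 2 : ℝ) * Ω x (J x v + minusConj Ω J x v) w = _
  rw [map_add, add_apply, hΩ.minusConj_apply]

/-- The metric has the same expression in J₋ as in J, so the argument that J is orthogonal also
serves for J₋. -/
theorem IsSymplectic.tamedQuadruple_g_apply' (J : ∀ x : M, TS E x →L[ℝ] TS E x) (x : M)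
    (v w : TS E x) :
    (tamedQuadruple Ω J).g x v w =
      (1 / 2 : ℝ) * (Ω x (minusConj Ω J x v) w + Ω x (minusConj Ω J x w) v) := by
  rw [hΩ.tamedQuadruple_g_apply, hΩ.minusConj_apply, hΩ.minusConj_apply, add_comm]

theorem IsSymplectic.tamedQuadruple_b_apply (J : ∀ x : M, TS E x →L[ℝ] TS E x) (x : M)
    (v w : TS E x) :
    (tamedQuadruple Ω J).b x v w = -((1 / 2 : ℝ) * (Ω x (J x v) w - Ω x (J x w) v)) := by
  change -((1 / 2 : ℝ) * Ω x (J x v - minusConj Ω J x v) w) = _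
  rw [map_sub, sub_apply, hΩ.minusConj_apply]

omit [FiniteDimensional ℝ E] in
theorem IsSymplectic.apply_ac {J : ∀ x : M, TS E x →L[ℝ] TS E x} (hJ : IsAlmostComplex J) (x : M)
    (v w : TS E x) : Ω x (J x (J x v)) (J x w) = Ω x (J x w) v := by
  rw [hJ.sq, map_neg, neg_apply, hΩ.skew x (J x w) v]

/-- Here g and -b are the symmetric and skew parts of Ω(J·, ·), so taming is positivity of g.
Applying J to both arguments exchanges the two terms of g. -/
theorem IsSymplectic.tamedQuadruple_isAlmostBihermitian {J : ∀ x : M, TS E x →L[ℝ] TS E x}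
    (hJ : IsAlmostComplex J) (ht : Tames Ω J) : (tamedQuadruple Ω J).IsAlmostBihermitian where
  g_smooth := (hΩ.smooth.comp_tt
    (hJ.smooth.add (hΩ.isAlmostComplex_minusConj hJ).smooth)).smul (1 / 2)
  g_symm x v w := by
    rw [hΩ.tamedQuadruple_g_apply, hΩ.tamedQuadruple_g_apply, add_comm]
  g_pos x v hv := by
    rw [hΩ.tamedQuadruple_g_apply]
    linarith [ht x v hv]
  b_smooth := ((hΩ.smooth.comp_tt
    (hJ.smooth.sub (hΩ.isAlmostComplex_minusConj hJ).smooth)).smul (1 / 2)).neg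
  b_alt x v := by
    rw [hΩ.tamedQuadruple_b_apply, sub_self, mul_zero, neg_zero]
  Jp_ac := hJ
  Jm_ac := hΩ.isAlmostComplex_minusConj hJ
  Jp_herm x v w := by
    change (tamedQuadruple Ω J).g x (J x v) (J x w) = _
    rw [hΩ.tamedQuadruple_g_apply, hΩ.tamedQuadruple_g_apply, hΩ.apply_ac hJ, hΩ.apply_ac hJ,
      add_comm]
  Jm_herm x v w := by
    change (tamedQuadruple Ω J).g x (minusConj Ω J x v) (minusConj Ω J x w) = _
    have hm := hΩ.isAlmostComplex_minusConj hJ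
    rw [hΩ.tamedQuadruple_g_apply', hΩ.tamedQuadruple_g_apply', hΩ.apply_ac hm, hΩ.apply_ac hm,
      add_comm]

theorem IsSymplectic.gen₁_tamedQuadruple {J : ∀ x : M, TS E x →L[ℝ] TS E x}
    (hJ : IsAlmostComplex J) (ht : Tames Ω J) : (tamedQuadruple Ω J).gen₁ = genOmega Ω := by
  have hq := hΩ.tamedQuadruple_isAlmostBihermitian hJ ht
  have hm := hΩ.isAlmostComplex_minusConj hJ
  funext x
  refine ContinuousLinearMap.ext fun u ↦ ?_
  obtain ⟨v, w, rfl⟩ := hq.exists_decomposition x u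
  rw [hq.gen₁_decomposed, gen_map_add]
  congr 1
  · rw [tamedQuadruple_plus, tamedQuadruple_plus, hΩ.genOmega_apply]
    refine Prod.ext rfl ?_
    change Ω x (J x (J x v)) = _
    rw [hJ.sq, map_neg]
  · rw [tamedQuadruple_minus, tamedQuadruple_minus, ← (Ω x).map_neg, ← (Ω x).map_neg,
      hΩ.genOmega_apply]
    refine Prod.ext rfl ?_
    change Ω x (-(minusConj Ω J x (-(minusConj Ω J x w)))) = _
    rw [(minusConj Ω J x).map_neg, hm.sq, neg_neg, map_neg]

/-- A quadruple whose first structure is `𝒥_Ω` is determined by `J₊`. -/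
theorem IsSymplectic.eq_tamedQuadruple {q : Quadruple E M} (hq : q.IsAlmostBihermitian)
    (h : q.gen₁ = genOmega Ω) : Tames Ω q.Jp ∧ q = tamedQuadruple Ω q.Jp := by
  have hp (x : M) (v : TS E x) : q.g x v - q.b x v = Ω x (q.Jp x v) := by
    have h1 := congrArg Prod.fst (hq.gen₁_plus x v)
    rw [h, hΩ.genOmega_apply'] at h1
    change (Ω x).inverse (q.g x v - q.b x v) = q.Jp x v at h1
    rw [← h1, apply_inverse_tc (hΩ.isInvertible x)]
  have hm (x : M) (v : TS E x) : q.g x v + q.b x v = Ω x (q.Jm x v) := by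
    have h1 := congrArg Prod.fst (hq.gen₁_minus x v)
    rw [h, hΩ.genOmega_apply'] at h1
    change (Ω x).inverse (-q.g x v - q.b x v) = -q.Jm x v at h1
    rw [← neg_neg (q.Jm x v), ← h1, map_neg, apply_inverse_tc (hΩ.isInvertible x)]
    abel
  -- Ω(J₋v, w) = g(v, w) + b(v, w) = g(w, v) - b(w, v) = Ω(J₊w, v).
  have hc : q.Jm = minusConj Ω q.Jp := hΩ.eq_minusConj fun x v w ↦ by
    rw [← hp, ← hm, add_apply, sub_apply, hq.g_symm x v w, hq.b_skew x v w, sub_eq_add_neg]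
  refine ⟨fun x v hv ↦ ?_, Quadruple.ext ?_ ?_ rfl hc⟩
  · rw [← hp, sub_apply, hq.b_alt, sub_zero]
    exact hq.g_pos x v hv
  · ext x v : 2
    change _ = (1 / 2 : ℝ) • Ω x (q.Jp x v + minusConj Ω q.Jp x v)
    rw [← hc, map_add, ← hp, ← hm]
    module
  · ext x v : 2
    change _ = -((1 / 2 : ℝ) • Ω x (q.Jp x v - minusConj Ω q.Jp x v))
    rw [← hc, map_sub, ← hp, ← hm]
    module

omit hΩ in
-- The kernel of 𝒥₁ - 𝒥₂ is no larger than C₊: on a C₋ component w, equality would give J₋w = -J₋w.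
theorem Quadruple.IsAlmostBihermitian.eq_plus {q : Quadruple E M} (hq : q.IsAlmostBihermitian)
    {x : M} {u : GenT E x} (h : q.gen₁ x u = q.gen₂ x u) : u = q.plus x u.1 := by
  obtain ⟨v, w, rfl⟩ := hq.exists_decomposition x u
  rw [hq.gen₁_decomposed, hq.gen₂_decomposed] at h
  have h1 : -q.Jm x w = q.Jm x w := congrArg Prod.fst (add_left_cancel h)
  have hw : w = 0 := hq.Jm_ac.eq_zero x w (eq_zero_of_eq_neg_self h1.symm)
  have h0 : q.minus x w = 0 := by
    rw [hw]
    refine Prod.ext rfl ?_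
    simp only [minus, map_zero, Prod.snd_zero, sub_zero, neg_zero]
  rw [h0, add_zero]
  rfl

omit hΩ in
theorem Quadruple.IsAlmostBihermitian.eq_minus {q : Quadruple E M} (hq : q.IsAlmostBihermitian)
    {x : M} {u : GenT E x} (h : q.gen₂ x u = -q.gen₁ x u) : u = q.minus x u.1 := by
  obtain ⟨v, w, rfl⟩ := hq.exists_decomposition x u
  rw [hq.gen₁_decomposed, hq.gen₂_decomposed, q.neg_decomposed, neg_neg] at h
  have h1 : q.Jp x v = -q.Jp x v := congrArg Prod.fst (add_right_cancel h)
  have hv : v = 0 := hq.Jp_ac.eq_zero x v (eq_zero_of_eq_neg_self h1)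
  have h0 : q.plus x v = 0 := by
    rw [hv]
    refine Prod.ext rfl ?_
    simp only [plus, map_zero, Prod.snd_zero, sub_zero]
  rw [h0, zero_add]
  rfl

/-- The second structure determines C₊ as the locus where it agrees with 𝒥_Ω, and C₊ is the graph of
ΩJ. -/
theorem IsSymplectic.gen₂_tamedQuadruple_injective {J K : ∀ x : M, TS E x →L[ℝ] TS E x}
    (hJ : IsAlmostComplex J) (hJt : Tames Ω J) (hK : IsAlmostComplex K) (hKt : Tames Ω K)
    (h : (tamedQuadruple Ω J).gen₂ = (tamedQuadruple Ω K).gen₂) : J = K := by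
  have hq := hΩ.tamedQuadruple_isAlmostBihermitian hJ hJt
  have hr := hΩ.tamedQuadruple_isAlmostBihermitian hK hKt
  ext x v
  have h1 : (tamedQuadruple Ω K).gen₁ x ((tamedQuadruple Ω J).plus x v) =
      (tamedQuadruple Ω K).gen₂ x ((tamedQuadruple Ω J).plus x v) := by
    rw [← h, hΩ.gen₁_tamedQuadruple hK hKt, ← hΩ.gen₁_tamedQuadruple hJ hJt, hq.gen₁_plus,
      hq.gen₂_plus]
  have h2 := hr.eq_plus h1
  rw [tamedQuadruple_plus, tamedQuadruple_plus] at h2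
  exact hΩ.inj x (congrArg Prod.snd h2)

/-- The structure J is found from the condition that ker(𝒥 - 𝒥_Ω) be the graph of ΩJ. Once that is
known, 𝒥 is forced on this graph, and positivity of 𝒢 forces it on the orthogonal graph. -/
theorem IsSymplectic.exists_tamed {𝒥 : ∀ x : M, GenT E x →L[ℝ] GenT E x}
    (h : IsAlmostGK (genOmega Ω) 𝒥) :
    ∃ J, IsAlmostComplex J ∧ Tames Ω J ∧ (tamedQuadruple Ω J).gen₂ = 𝒥 := by
  have := FiniteDimensional.complete ℝ E
  set A : ∀ x : M, TS E x →L[ℝ] TS E x := fun x ↦ (ContinuousLinearMap.fst ℝ (TS E x) (CoT E x)).comp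
    ((𝒥 x).comp (ContinuousLinearMap.inl ℝ (TS E x) (CoT E x))) with hA
  set β : ∀ x : M, CoT E x →L[ℝ] TS E x := fun x ↦
    (ContinuousLinearMap.fst ℝ (TS E x) (CoT E x)).comp
    ((𝒥 x).comp (ContinuousLinearMap.inr ℝ (TS E x) (CoT E x))) with hβ
  have hAs : SmoothTT A := h.snd.smooth.1
  have hβs : SmoothCT β := h.snd.smooth.2.1
  have hfst (x : M) (v : TS E x) (ξ : CoT E x) : (𝒥 x (v, ξ)).1 = A x v + β x ξ := by
    have h1 : ((v, ξ) : GenT E x) = (v, 0) + (0, ξ) := by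
      rw [Prod.mk_add_mk, add_zero, zero_add]
    rw [h1, gen_map_add]
    rfl
  have hβz (x : M) : β x 0 = 0 := (β x).toLinearMap.map_zero
  have hβn (x : M) (ξ : CoT E x) : β x (-ξ) = -β x ξ := (β x).toLinearMap.map_neg ξ
  have hj := hΩ.genOmega_sq
  -- If Av = 0, then 𝒢(v, 0) has no covector part, hence pairs to zero with (v, 0), against
  -- positivity.
  have hAinj (x : M) (v : TS E x) (hv : A x v = 0) : v = 0 := by
    by_contra hne
    have hne' : ((v, 0) : GenT E x) ≠ 0 := fun h0 ↦ hne (congrArg Prod.fst h0)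
    have h1 := h.pos x _ hne'
    have h2 : (-genOmega Ω x (𝒥 x (v, 0))).2 = 0 := by
      rw [hΩ.genOmega_apply', hfst, hv]
      change - -Ω x (0 + β x 0) = 0
      rw [hβz, zero_add, map_zero, neg_zero, neg_zero]
    simp only [pairing, h2, zero_apply, add_zero, mul_zero, lt_irrefl] at h1
  have hAinv (x : M) : (A x).IsInvertible := isInvertible_tt _ (hAinj x)
  -- If (v, Ωw) lies in ker(𝒥 - 𝒥_Ω), so does its image (w, -Ωv) under 𝒥_Ω. The vector part of the
  -- equation there reads Aw - βΩv = -v, which is solved for w.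
  set J : ∀ x : M, TS E x →L[ℝ] TS E x := fun x ↦
    (A x).inverse.comp ((β x).comp (Ω x) - ContinuousLinearMap.id ℝ (TS E x)) with hJdef
  have hAJ (x : M) (v : TS E x) : A x (J x v) = β x (Ω x v) - v :=
    apply_inverse_tt (hAinv x) _
  -- The hypothesis on u says 𝒢u = -u, so ⟨𝒢u, u⟩ = -⟨u, u⟩ = 0 and positivity gives u = 0.
  have hzero (x : M) (u : GenT E x) (h1 : 𝒥 x u = -genOmega Ω x u) (h2 : pairing u u = 0) :
      u = 0 := by
    by_contra hne
    have h3 := h.pos x u hne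
    rw [h1, gen_map_neg, hj, neg_neg, pairing_neg_left, h2, neg_zero] at h3
    exact lt_irrefl _ h3
  have hgraph (x : M) (v : TS E x) :
      𝒥 x (v, Ω x (J x v)) = genOmega Ω x (v, Ω x (J x v)) := by
    set u : GenT E x := (v, Ω x (J x v)) with hu
    -- Here d = 𝒢u - u lies in the -1-eigenspace because 𝒢² = 1. The choice of J kills its vector
    -- part, so d is null and therefore zero.
    set d : GenT E x := -(genOmega Ω x (𝒥 x u) + u) with hd
    have hd1 : d.1 = 0 := by
      rw [hd, h.comm, hu, hΩ.genOmega_apply]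
      change -((𝒥 x (J x v, -Ω x v)).1 + v) = 0
      rw [hfst, hAJ, hβn]
      abel
    have hd0 : d = 0 := by
      refine hzero x d ?_ ?_
      · rw [hd, gen_map_neg, gen_map_neg, gen_map_add, gen_map_add, ← h.comm, h.snd.sq, hj,
          gen_map_neg]
        abel
      · rw [pairing, hd1, map_zero, add_zero, mul_zero]
    have h1 : genOmega Ω x (𝒥 x u) = -u := eq_neg_of_add_eq_zero_left (neg_eq_zero.1 hd0)
    have h2 := congrArg (genOmega Ω x) h1
    rw [hj, gen_map_neg] at h2
    exact neg_injective h2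
  have hgraph' (x : M) (u : GenT E x) (hu : 𝒥 x u = genOmega Ω x u) :
      u.2 = Ω x (J x u.1) := by
    have h1 : 𝒥 x ((Ω x).inverse u.2, -Ω x u.1) = -u := by
      rw [← hΩ.genOmega_apply', ← hu, h.snd.sq]
    have h2 := congrArg Prod.fst h1
    rw [hfst] at h2
    have h3 : A x ((Ω x).inverse u.2) = A x (J x u.1) := by
      rw [hAJ]
      rw [hβn] at h2
      have h5 : (-u).1 = -u.1 := rfl
      rw [h5] at h2
      rw [← sub_eq_add_neg, sub_eq_iff_eq_add] at h2
      rw [h2]; abel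
    have h6 : (Ω x).inverse u.2 = J x u.1 := by
      refine sub_eq_zero.1 (hAinj x _ ?_)
      rw [map_sub, h3, sub_self]
    rw [← h6, apply_inverse_tc (hΩ.isInvertible x)]
  have hJ : IsAlmostComplex J := by
    refine ⟨(hAs.inverse hAinv).comp ((hβs.comp_tc hΩ.smooth).sub smoothTT_id), fun x v ↦ ?_⟩
    -- Since 𝒥_Ω commutes with 𝒥 it preserves the graph; its value (Jv, -Ωv) there gives ΩJ²v = -Ωv.
    have h1 := hgraph' x (genOmega Ω x (v, Ω x (J x v))) (by rw [← h.comm, hgraph])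
    rw [hΩ.genOmega_apply] at h1
    refine hΩ.inj x (h1.symm.trans ?_)
    rw [map_neg]
  have ht : Tames Ω J := by
    intro x v hv
    have hne : ((v, Ω x (J x v)) : GenT E x) ≠ 0 := fun h0 ↦ hv (congrArg Prod.fst h0)
    -- On the graph 𝒢 is the identity, so positivity says ⟨u, u⟩ = Ω(Jv, v) > 0.
    have h1 := h.pos x _ hne
    rw [hgraph, hj, neg_neg] at h1
    simp only [pairing] at h1
    linarith
  have hq := hΩ.tamedQuadruple_isAlmostBihermitian hJ ht
  have hg := hΩ.gen₁_tamedQuadruple hJ ht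
  refine ⟨J, hJ, ht, ?_⟩
  funext x
  refine ContinuousLinearMap.ext fun u ↦ ?_
  obtain ⟨v, w, rfl⟩ := hq.exists_decomposition x u
  rw [hq.gen₂_decomposed, gen_map_add]
  congr 1
  · rw [tamedQuadruple_plus J x v, hgraph, ← tamedQuadruple_plus J x v, ← hg, hq.gen₁_plus]
  · set m := (tamedQuadruple Ω J).minus x w with hm
    -- With z = m + 𝒢m one has 𝒢z = z, so z lies in the plus graph, which is orthogonal to m. Then
    -- ⟨z, z⟩ = ⟨m, z⟩ + ⟨m, 𝒢z⟩ = 2⟨m, z⟩ = 0, and positivity gives z = 0, that is, 𝒥m = -𝒥_Ωm.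
    set z : GenT E x := m + -genOmega Ω x (𝒥 x m) with hz
    have hz1 : 𝒥 x z = genOmega Ω x z := by
      rw [hz, gen_map_add, gen_map_add, gen_map_neg, gen_map_neg, ← h.comm, h.snd.sq, gen_map_neg,
        hj]
      abel
    have hz2 : z = (tamedQuadruple Ω J).plus x z.1 := by
      rw [tamedQuadruple_plus]
      exact Prod.ext rfl (hgraph' x z hz1)
    have hmz : pairing m z = 0 := by
      rw [hz2, hm, hq.pairing_minus_plus]
    have hzz : -genOmega Ω x (𝒥 x z) = z := by rw [hz1, hj, neg_neg]
    have hz0 : z = 0 := by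
      by_contra hne
      have h1 := h.pos x z hne
      rw [hzz] at h1
      have h2 : pairing z z = pairing m z + pairing (-genOmega Ω x (𝒥 x m)) z := by
        conv_lhs => rw [hz]
        rw [pairing_add_left]
      rw [h2, h.symm, hzz, pairing_comm z m, hmz, add_zero] at h1
      exact lt_irrefl _ h1
    have h3 : m = genOmega Ω x (𝒥 x m) := by
      rw [hz, ← sub_eq_add_neg] at hz0
      exact sub_eq_zero.1 hz0
    have h4 : 𝒥 x m = -genOmega Ω x m := by
      conv_rhs => rw [h3, hj, neg_neg]
    rw [h4, ← hg, hm, hq.gen₁_minus, Quadruple.minus_neg, neg_neg]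

end Tamed


/-! ### Courant brackets of vector fields and 1-forms; linearity and nondegeneracy. -/

section CourantSpecial

variable {E : Type*} [NormedAddCommGroup E] [NormedSpace ℝ E]
  {M : Type*} [TopologicalSpace M] [ChartedSpace E M]

set_option synthInstance.maxHeartbeats 200000 in
theorem dCo_zero (x : M) (v : TS E x) : dCo (fun y : M ↦ (0 : CoT E y)) x v = 0 := by
  have h : fderiv ℝ (chartCo (fun y : M ↦ (0 : CoT E y)) x) (extChartAt 𝓘(ℝ, E) x x) = 0 := by
    have h1 : chartCo (fun y : M ↦ (0 : CoT E y)) x = fun _ ↦ 0 := rfl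
    rw [h1, fderiv_const_apply]
  have key (D : E →L[ℝ] E) (w : E) :
      (((0 : E →L[ℝ] E →L[ℝ] ℝ) - (0 : E →L[ℝ] E →L[ℝ] ℝ).flip) (D w)).comp D = 0 := by
    ext z
    simp
  unfold dCo
  rw [h]
  exact key _ _

theorem dCo_apply_zero (ξ : ∀ x : M, CoT E x) (x : M) : dCo ξ x 0 = 0 := by
  have key (a : E →L[ℝ] E →L[ℝ] ℝ) (D : E →L[ℝ] E) : (a (D 0)).comp D = 0 := by
    rw [map_zero, map_zero, ContinuousLinearMap.zero_comp]
  exact key _ _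

theorem courant_vector_vector (X Y : ∀ x : M, TS E x) (x : M) :
    courant (fun y ↦ (X y, 0)) (fun y ↦ (Y y, 0)) x =
      (VectorField.mlieBracket 𝓘(ℝ, E) X Y x, 0) := by
  refine Prod.ext rfl ?_
  change dCo (fun y : M ↦ (0 : CoT E y)) x (X x) - dCo (fun y : M ↦ (0 : CoT E y)) x (Y x) +
    (1 / 2 : ℝ) • mvfderiv 𝓘(ℝ, E) (fun _ : M ↦ (0 : ℝ) - 0) x = 0
  rw [dCo_zero, dCo_zero, mvfderiv_const]
  simp

theorem courant_form_form (ξ η : ∀ x : M, CoT E x) (x : M) :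
    courant (fun y ↦ ((0 : TS E y), ξ y)) (fun y ↦ ((0 : TS E y), η y)) x = 0 := by
  refine Prod.ext ?_ ?_
  · exact congrFun (VectorField.mlieBracket_zero_left (𝕜 := ℝ) (I := 𝓘(ℝ, E)) (M := M)
      (W := fun y : M ↦ (0 : TS E y))) x
  · have h : (fun y : M ↦ η y 0 - ξ y 0) = fun _ ↦ (0 : ℝ) := by
      ext y; rw [map_zero, map_zero, sub_zero]
    change dCo η x 0 - dCo ξ x 0 + (1 / 2 : ℝ) • mvfderiv 𝓘(ℝ, E) (fun y : M ↦ η y 0 - ξ y 0) x = 0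
    rw [dCo_apply_zero, dCo_apply_zero, h, mvfderiv_const]
    simp

theorem courant_vector_form (X : ∀ x : M, TS E x) (η : ∀ x : M, CoT E x) (x : M) :
    courant (fun y ↦ (X y, 0)) (fun y ↦ ((0 : TS E y), η y)) x =
      (0, dCo η x (X x) + (1 / 2 : ℝ) • mvfderiv 𝓘(ℝ, E) (fun y ↦ η y (X y)) x) := by
  refine Prod.ext ?_ ?_
  · exact congrFun (VectorField.mlieBracket_zero_right (𝕜 := ℝ) (I := 𝓘(ℝ, E)) (M := M)
      (W := X)) x
  · have h : (fun y : M ↦ η y (X y) - (0 : CoT E y) 0) = fun y ↦ η y (X y) := by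
      ext y; rw [map_zero, sub_zero]
    change dCo η x (X x) - dCo (fun y : M ↦ (0 : CoT E y)) x 0 +
      (1 / 2 : ℝ) • mvfderiv 𝓘(ℝ, E) (fun y : M ↦ η y (X y) - (0 : CoT E y) 0) x = _
    rw [dCo_zero, h, sub_zero]

variable [IsManifold 𝓘(ℝ, E) ∞ M]

theorem SmoothGen.neg {u : ∀ x : M, GenT E x} (hu : SmoothGen u) : SmoothGen (fun x ↦ -u x) :=
  ⟨SmoothVF.neg hu.1, SmoothCo.neg hu.2⟩

theorem courant_neg_left [CompleteSpace E] {u v : ∀ x : M, GenT E x} (hu : SmoothGen u)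
    (hv : SmoothGen v) (x : M) : courant (fun y ↦ -u y) v x = -courant u v x := by
  have h0 : SmoothGen fun y : M ↦ (0 : GenT E y) := ⟨smoothVF_zero, smoothCo_zero⟩
  have h1 := courant_add_left h0 h0 hv x
  simp only [add_zero, left_eq_add] at h1
  have h2 := courant_add_left hu.neg hu hv x
  simp only [neg_add_cancel] at h2
  exact eq_neg_of_add_eq_zero_left (h2.symm.trans h1)

theorem courant_neg_right [CompleteSpace E] {u v : ∀ x : M, GenT E x} (hu : SmoothGen u)
    (hv : SmoothGen v) (x : M) : courant u (fun y ↦ -v y) x = -courant u v x := by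
  rw [courant_swap, courant_neg_left hv hu, courant_swap u v]

/-- Replacing a by 𝒥a permutes the four brackets up to sign and 𝒥. Hence vanishing on a and b gives
vanishing on 𝒥a and b. -/
theorem IsAlmostGC.genNijenhuis_apply_left [CompleteSpace E]
    {𝒥 : ∀ x : M, GenT E x →L[ℝ] GenT E x} (h𝒥 : IsAlmostGC 𝒥) {a b : ∀ x : M, GenT E x}
    (ha : SmoothGen a) (hb : SmoothGen b) (x : M) :
    genNijenhuis 𝒥 (fun y ↦ 𝒥 y (a y)) b x = -𝒥 x (genNijenhuis 𝒥 a b x) := by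
  unfold genNijenhuis
  simp only [h𝒥.sq]
  rw [courant_neg_left ha hb, courant_neg_left ha (h𝒥.smooth.apply hb)]
  simp only [sub_eq_add_neg, gen_map_add, gen_map_neg, h𝒥.sq, neg_add, neg_neg]
  abel

theorem exists_smoothVF_eq [FiniteDimensional ℝ E] [T2Space M] {x : M} (v : TS E x) :
    ∃ X : ∀ y : M, TS E y, SmoothVF X ∧ X x = v :=
  exists_contMDiff_section_eq (EB := E) (V := fun y : M ↦ TS E y) E x v

theorem exists_smoothCo_eq [FiniteDimensional ℝ E] [T2Space M] {x : M} (ξ : CoT E x) :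
    ∃ η : ∀ y : M, CoT E y, SmoothCo η ∧ η x = ξ :=
  exists_contMDiff_section_eq (EB := E) (V := fun y : M ↦ CoT E y) (E →L[ℝ] ℝ) x ξ

/-- The pairing is nondegenerate, and every vector and covector at x extends to a global smooth
section. -/
theorem eq_zero_of_pairing {x : M} [FiniteDimensional ℝ E] [T2Space M] {u : GenT E x}
    (h : ∀ c : ∀ y : M, GenT E y, SmoothGen c → pairing u (c x) = 0) : u = 0 := by
  have h1 (v : TS E x) : u.2 v = 0 := by
    obtain ⟨s, hs, hsx⟩ := exists_smoothVF_eq v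
    have h2 := h (fun y ↦ (s y, 0)) ⟨hs, smoothCo_zero⟩
    simp only [pairing, hsx, zero_apply] at h2
    linarith
  have h2 (ξ : CoT E x) : ξ u.1 = 0 := by
    obtain ⟨s, hs, hsx⟩ := exists_smoothCo_eq ξ
    have h2 := h (fun y ↦ (0, s y)) ⟨smoothVF_zero, hs⟩
    simp only [pairing, hsx, map_zero] at h2
    linarith
  refine Prod.ext ?_ (ContinuousLinearMap.ext h1)
  have key (e : E) (he : ∀ ξ : E →L[ℝ] ℝ, ξ e = 0) : e = 0 :=
    (SeparatingDual.eq_zero_iff_forall_dual_eq_zero (R := ℝ) e).2 he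
  exact key u.1 h2

end CourantSpecial

/-! ### Integrability of 𝒥_Ω. -/

section SymplecticIntegrable

variable {E : Type*} [NormedAddCommGroup E] [NormedSpace ℝ E] [FiniteDimensional ℝ E]
  {M : Type*} [TopologicalSpace M] [T2Space M] [ChartedSpace E M] [IsManifold 𝓘(ℝ, E) ∞ M]
  {Ω : ∀ x : M, TS E x →L[ℝ] CoT E x} (hΩ : IsSymplectic Ω)

include hΩ

omit [T2Space M] in
/-- `𝒥_Ω` is an almost generalized complex structure. -/
theorem IsSymplectic.isAlmostGC : IsAlmostGC (genOmega Ω) where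
  smooth := by
    have := FiniteDimensional.complete ℝ E
    exact smoothGenEnd_blocks smoothTT_zero (hΩ.smooth.inverse hΩ.isInvertible) hΩ.smooth.neg
      smoothCC_zero
  sq := hΩ.genOmega_sq
  orth x u v := by
    have h (w z : GenT E x) : Ω x w.1 ((Ω x).inverse z.2) = -z.2 w.1 := by
      rw [hΩ.skew, apply_inverse_tc (hΩ.isInvertible x)]
    rw [hΩ.genOmega_apply', hΩ.genOmega_apply']
    simp only [pairing, neg_apply, h, neg_neg]
    ring

/-- This is where dΩ = 0 enters: it is ι_[X,Y]Ω = L_X ι_YΩ - ι_Y L_XΩ with L_XΩ = d(ι_XΩ), tested on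
an arbitrary third field Z. -/
theorem IsSymplectic.dCo_sub_dCo {X Y : ∀ x : M, TS E x} (hX : SmoothVF X) (hY : SmoothVF Y)
    (x : M) :
    dCo (fun y ↦ Ω y (Y y)) x (X x) - dCo (fun y ↦ Ω y (X y)) x (Y x) -
      mvfderiv 𝓘(ℝ, E) (fun y ↦ Ω y (X y) (Y y)) x =
      Ω x (VectorField.mlieBracket 𝓘(ℝ, E) X Y x) := by
  refine ContinuousLinearMap.ext fun v ↦ ?_
  obtain ⟨Z, hZ, rfl⟩ := exists_smoothVF_eq v
  have hc := hΩ.closed.invariant hΩ.smooth hΩ.alt hX hY hZ x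
  have h1 := dCo_apply (hΩ.smooth.apply hY) hX hZ x
  have h2 := dCo_apply (hΩ.smooth.apply hX) hY hZ x
  have hs : mvfderiv 𝓘(ℝ, E) (fun y ↦ Ω y (Y y) (X y)) x (Z x) =
      -mvfderiv 𝓘(ℝ, E) (fun y ↦ Ω y (X y) (Y y)) x (Z x) := by
    have h : (fun y ↦ Ω y (Y y) (X y)) = -fun y ↦ Ω y (X y) (Y y) :=
      funext fun y ↦ hΩ.skew y _ _
    rw [h, mvfderiv_neg]
    rfl
  rw [sub_apply, sub_apply, h1, h2, hs]
  rw [hΩ.skew x _ (Y x), hΩ.skew x _ (X x)] at hc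
  linarith

/-- The symplectic structure `𝒥_Ω` is integrable. -/
theorem IsSymplectic.genNijenhuis_eq_zero {a b : ∀ x : M, GenT E x} (ha : SmoothGen a)
    (hb : SmoothGen b) (x : M) : genNijenhuis (genOmega Ω) a b x = 0 := by
  have := FiniteDimensional.complete ℝ E
  have hj := hΩ.isAlmostGC
  have hform (X : ∀ x : M, TS E x) :
      (fun y ↦ genOmega Ω y (0, Ω y (X y))) = fun y ↦ ((X y, 0) : GenT E y) := by
    funext y
    rw [hΩ.genOmega_apply, map_zero, neg_zero]
  have hsm {X : ∀ x : M, TS E x} (hX : SmoothVF X) :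
      SmoothGen fun y ↦ ((0, Ω y (X y)) : GenT E y) := ⟨smoothVF_zero, hΩ.smooth.apply hX⟩
  -- For forms ΩX and ΩY, 𝒥_Ω gives the fields X and Y. The form-form bracket vanishes, the
  -- field-field bracket is [X, Y], and the mixed brackets add up to Ω[X, Y], which 𝒥_Ω sends back
  -- to [X, Y].
  have base {X Y : ∀ x : M, TS E x} (hX : SmoothVF X) (hY : SmoothVF Y) :
      genNijenhuis (genOmega Ω) (fun y ↦ (0, Ω y (X y))) (fun y ↦ (0, Ω y (Y y))) x = 0 := by
    unfold genNijenhuis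
    simp only [hform]
    rw [courant_form_form, courant_vector_vector, courant_vector_form,
      courant_swap (fun y ↦ (0, Ω y (X y))), courant_vector_form]
    have hs : mvfderiv 𝓘(ℝ, E) (fun y ↦ Ω y (Y y) (X y)) x =
        -mvfderiv 𝓘(ℝ, E) (fun y ↦ Ω y (X y) (Y y)) x := by
      have h : (fun y ↦ Ω y (Y y) (X y)) = -fun y ↦ Ω y (X y) (Y y) :=
        funext fun y ↦ hΩ.skew y _ _
      rw [h, mvfderiv_neg]
    have hσ : ((0, dCo (fun y ↦ Ω y (Y y)) x (X x) +
          (1 / 2 : ℝ) • mvfderiv 𝓘(ℝ, E) (fun y ↦ Ω y (Y y) (X y)) x) : GenT E x) +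
        -(0, dCo (fun y ↦ Ω y (X y)) x (Y x) +
          (1 / 2 : ℝ) • mvfderiv 𝓘(ℝ, E) (fun y ↦ Ω y (X y) (Y y)) x) =
        (0, Ω x (VectorField.mlieBracket 𝓘(ℝ, E) X Y x)) := by
      refine Prod.ext ?_ ?_
      · exact add_neg_cancel (0 : TS E x)
      · rw [← hΩ.dCo_sub_dCo hX hY, hs]
        simp only [Prod.snd_add, Prod.snd_neg]
        module
    rw [hσ, hΩ.genOmega_apply, map_zero, neg_zero, zero_sub, neg_add_cancel]
  -- Every section is ΩY + 𝒥_Ω(ΩX), so additivity and 𝒥-antilinearity of N reduce one slot to forms.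
  -- Antisymmetry then treats the other slot.
  have reduce {c : ∀ x : M, GenT E x} (hc : SmoothGen c)
      (h : ∀ X : ∀ x : M, TS E x, SmoothVF X →
        genNijenhuis (genOmega Ω) (fun y ↦ (0, Ω y (X y))) c x = 0)
      {d : ∀ x : M, GenT E x} (hd : SmoothGen d) : genNijenhuis (genOmega Ω) d c x = 0 := by
    have hY : SmoothVF fun y ↦ (Ω y).inverse (d y).2 :=
      (hΩ.smooth.inverse hΩ.isInvertible).apply hd.2
    have hd' : d = fun y ↦ ((0, Ω y ((Ω y).inverse (d y).2)) : GenT E y) +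
        genOmega Ω y (0, Ω y (d y).1) := by
      funext y
      rw [hΩ.genOmega_apply, apply_inverse_tc (hΩ.isInvertible y), map_zero, neg_zero,
        Prod.mk_add_mk, zero_add, add_zero]
    rw [hd', genNijenhuis_add_left hj.smooth (hsm hY) (hj.smooth.apply (hsm hd.1)) hc,
      hj.genNijenhuis_apply_left (hsm hd.1) hc, h _ hY, h _ hd.1, zero_add]
    exact neg_eq_zero.2 ((genOmega Ω x).toLinearMap.map_zero)
  refine reduce hb (fun X hX ↦ ?_) ha
  rw [genNijenhuis_swap, neg_eq_zero]
  refine reduce (hsm hX) (fun Y hY ↦ base hY hX) hb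

end SymplecticIntegrable


/-! ### Integrability of the pair in terms of J and J₋. -/

section TamedIntegrability

variable {E : Type*} [NormedAddCommGroup E] [NormedSpace ℝ E]
  {M : Type*} [TopologicalSpace M] [ChartedSpace E M] [IsManifold 𝓘(ℝ, E) ∞ M]

theorem Quadruple.IsAlmostBihermitian.smoothGen_plus {q : Quadruple E M}
    (hq : q.IsAlmostBihermitian) {X : ∀ x : M, TS E x} (hX : SmoothVF X) :
    SmoothGen fun x ↦ q.plus x (X x) :=
  ⟨hX, (hq.g_smooth.sub hq.b_smooth).apply hX⟩

theorem Quadruple.IsAlmostBihermitian.smoothGen_minus {q : Quadruple E M}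
    (hq : q.IsAlmostBihermitian) {X : ∀ x : M, TS E x} (hX : SmoothVF X) :
    SmoothGen fun x ↦ q.minus x (X x) :=
  ⟨hX, (hq.g_smooth.neg.sub hq.b_smooth).apply hX⟩

variable [FiniteDimensional ℝ E]

/-- Smooth sections of `TM ⊕ T*M` decompose smoothly along the eigenbundles of `𝒢`. -/
theorem Quadruple.IsAlmostBihermitian.exists_smooth_decomposition {q : Quadruple E M}
    (hq : q.IsAlmostBihermitian) {u : ∀ x : M, GenT E x} (hu : SmoothGen u) :
    ∃ X Y, SmoothVF X ∧ SmoothVF Y ∧ u = fun x ↦ q.plus x (X x) + q.minus x (Y x) := by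
  have := FiniteDimensional.complete ℝ E
  have hz : SmoothVF fun x ↦ (q.g x).inverse ((u x).2 + q.b x (u x).1) :=
    (hq.g_smooth.inverse hq.g_inv).apply (hu.2.add (hq.b_smooth.apply hu.1))
  exact ⟨_, _, ContMDiff.const_smul_section (hu.1.add hz),
    ContMDiff.const_smul_section (ContMDiff.sub_section hu.1 hz),
    funext fun x ↦ hq.eq_plus_add_minus x (u x)⟩

variable [T2Space M]

/-- By cyclicity the mixed components of the Nijenhuis tensor of `𝒥₂` vanish as soon as the pure
ones do. -/
theorem Quadruple.IsAlmostBihermitian.genNijenhuis_eq_zero {q : Quadruple E M}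
    (hq : q.IsAlmostBihermitian) {𝒥 : ∀ x : M, GenT E x →L[ℝ] GenT E x} (h𝒥 : IsAlmostGC 𝒥)
    (hp : ∀ X Y : ∀ x : M, TS E x, SmoothVF X → SmoothVF Y → ∀ x,
      genNijenhuis 𝒥 (fun x ↦ q.plus x (X x)) (fun x ↦ q.plus x (Y x)) x = 0)
    (hm : ∀ X Y : ∀ x : M, TS E x, SmoothVF X → SmoothVF Y → ∀ x,
      genNijenhuis 𝒥 (fun x ↦ q.minus x (X x)) (fun x ↦ q.minus x (Y x)) x = 0)
    {a b : ∀ x : M, GenT E x} (ha : SmoothGen a) (hb : SmoothGen b) (x : M) :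
    genNijenhuis 𝒥 a b x = 0 := by
  have := FiniteDimensional.complete ℝ E
  have hz (u : GenT E x) : pairing (0 : GenT E x) u = 0 := by
    simp only [pairing, Prod.fst_zero, Prod.snd_zero, zero_apply, map_zero, add_zero, mul_zero]
  have mixed {X Y : ∀ x : M, TS E x} (hX : SmoothVF X) (hY : SmoothVF Y) :
      genNijenhuis 𝒥 (fun x ↦ q.plus x (X x)) (fun x ↦ q.minus x (Y x)) x = 0 := by
    refine eq_zero_of_pairing fun c hc ↦ ?_
    obtain ⟨Z, W, hZ, hW, rfl⟩ := hq.exists_smooth_decomposition hc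
    have hX' := hq.smoothGen_plus hX
    have hY' := hq.smoothGen_minus hY
    have hZ' := hq.smoothGen_plus hZ
    have hW' := hq.smoothGen_minus hW
    -- Rotate until the two sections of the same type are the arguments of N: ⟨N(X, Y), Z⟩ = ⟨N(Z,
    -- X), Y⟩ for Z of plus type, ⟨N(X, Y), W⟩ = ⟨N(Y, W), X⟩ for W of minus type.
    rw [pairing_add_right, pairing_genNijenhuis_cyclic h𝒥 hX' hY' hZ',
      pairing_genNijenhuis_cyclic h𝒥 hY' hZ' hX', hp Z X hZ hX, hz,
      pairing_genNijenhuis_cyclic h𝒥 hX' hY' hW', hm Y W hY hW, hz, add_zero]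
  obtain ⟨X, Y, hX, hY, rfl⟩ := hq.exists_smooth_decomposition ha
  obtain ⟨Z, W, hZ, hW, rfl⟩ := hq.exists_smooth_decomposition hb
  have hX' := hq.smoothGen_plus hX
  have hY' := hq.smoothGen_minus hY
  have hZ' := hq.smoothGen_plus hZ
  have hW' := hq.smoothGen_minus hW
  rw [genNijenhuis_add_left h𝒥.smooth hX' hY' (hZ'.add hW'),
    genNijenhuis_add_right h𝒥.smooth hX' hZ' hW', genNijenhuis_add_right h𝒥.smooth hY' hZ' hW',
    hp X Z hX hZ, hm Y W hY hW, mixed hX hW, genNijenhuis_swap, mixed hZ hY]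
  simp only [neg_zero, add_zero]

variable {Ω : ∀ x : M, TS E x →L[ℝ] CoT E x} (hΩ : IsSymplectic Ω)
  {J : ∀ x : M, TS E x →L[ℝ] TS E x} (hJ : IsAlmostComplex J) (ht : Tames Ω J)

include hΩ hJ ht

/-- Both structures act as J on plus sections, so their Nijenhuis expressions are p + 𝒥r and p +
𝒥_Ωr with the same p and r. The second is zero, so the first vanishes iff 𝒥r = 𝒥_Ωr, that is, r.2 =
ΩJ(r.1). Since p.1 = -Ω⁻¹(r.2), this is p.1 + J(r.1) = 0, the Nijenhuis condition for J. -/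
theorem IsSymplectic.genNijenhuis_plus {X Y : ∀ x : M, TS E x} (hX : SmoothVF X) (hY : SmoothVF Y)
    (x : M) :
    genNijenhuis (tamedQuadruple Ω J).gen₂ (fun x ↦ (tamedQuadruple Ω J).plus x (X x))
      (fun x ↦ (tamedQuadruple Ω J).plus x (Y x)) x = 0 ↔ nijenhuis J X Y x = 0 := by
  have hq := hΩ.tamedQuadruple_isAlmostBihermitian hJ ht
  have hg := hΩ.gen₁_tamedQuadruple hJ ht
  have hN := hΩ.genNijenhuis_eq_zero (hq.smoothGen_plus hX) (hq.smoothGen_plus hY) x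
  rw [← hg] at hN
  unfold genNijenhuis at hN ⊢
  simp only [hq.gen₁_plus] at hN
  simp only [hq.gen₂_plus]
  set r : GenT E x := courant (fun y ↦ (tamedQuadruple Ω J).plus y (J y (X y)))
      (fun y ↦ (tamedQuadruple Ω J).plus y (Y y)) x +
    courant (fun y ↦ (tamedQuadruple Ω J).plus y (X y))
      (fun y ↦ (tamedQuadruple Ω J).plus y (J y (Y y))) x with hr
  set p : GenT E x := courant (fun y ↦ (tamedQuadruple Ω J).plus y (X y))
      (fun y ↦ (tamedQuadruple Ω J).plus y (Y y)) x -
    courant (fun y ↦ (tamedQuadruple Ω J).plus y (J y (X y)))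
      (fun y ↦ (tamedQuadruple Ω J).plus y (J y (Y y))) x with hp
  change p + (tamedQuadruple Ω J).gen₁ x r = 0 at hN
  change p + (tamedQuadruple Ω J).gen₂ x r = 0 ↔ _
  have hnij : nijenhuis J X Y x = p.1 + J x r.1 := by
    have h1 : J x r.1 = J x (VectorField.mlieBracket 𝓘(ℝ, E) (fun y ↦ J y (X y)) Y x) +
        J x (VectorField.mlieBracket 𝓘(ℝ, E) X (fun y ↦ J y (Y y)) x) := map_add (J x) _ _
    rw [h1, ← add_assoc]
    rfl
  have hpr : p.1 = -(Ω x).inverse r.2 := by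
    have h1 := congrArg Prod.fst hN
    rw [hg, hΩ.genOmega_apply'] at h1
    exact eq_neg_of_add_eq_zero_left h1
  rw [hnij, hpr]
  constructor
  · intro h
    have h1 : r = (tamedQuadruple Ω J).plus x r.1 :=
      hq.eq_plus (add_left_cancel (hN.trans h.symm))
    rw [tamedQuadruple_plus] at h1
    have h2 : r.2 = Ω x (J x r.1) := congrArg Prod.snd h1
    rw [h2, inverse_tc_apply (hΩ.isInvertible x), neg_add_cancel]
  · intro h
    have h1 : (Ω x).inverse r.2 = J x r.1 := (neg_add_eq_zero.1 h)
    have h2 : r = (tamedQuadruple Ω J).plus x r.1 := by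
      rw [tamedQuadruple_plus, ← h1, apply_inverse_tc (hΩ.isInvertible x)]
    have h3 : (tamedQuadruple Ω J).gen₂ x r = (tamedQuadruple Ω J).gen₁ x r := by
      rw [h2, hq.gen₂_plus, hq.gen₁_plus]
    rw [h3, hN]

/-- As for plus sections, but 𝒥_Ω now acts as -J₋. Its signs cancel in the doubly rotated bracket
and survive in r, so integrability of 𝒥_Ω reads p - 𝒥_Ωr = 0 and the condition becomes 𝒥r = -𝒥_Ωr.
-/
theorem IsSymplectic.genNijenhuis_minus {X Y : ∀ x : M, TS E x} (hX : SmoothVF X)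
    (hY : SmoothVF Y) (x : M) :
    genNijenhuis (tamedQuadruple Ω J).gen₂ (fun x ↦ (tamedQuadruple Ω J).minus x (X x))
      (fun x ↦ (tamedQuadruple Ω J).minus x (Y x)) x = 0 ↔
      nijenhuis (minusConj Ω J) X Y x = 0 := by
  have := FiniteDimensional.complete ℝ E
  have hq := hΩ.tamedQuadruple_isAlmostBihermitian hJ ht
  have hg := hΩ.gen₁_tamedQuadruple hJ ht
  have hN := hΩ.genNijenhuis_eq_zero (hq.smoothGen_minus hX) (hq.smoothGen_minus hY) x
  have hX' := hq.smoothGen_minus hX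
  have hY' := hq.smoothGen_minus hY
  have hKX := hq.smoothGen_minus (hq.Jm_ac.smooth.apply hX)
  have hKY := hq.smoothGen_minus (hq.Jm_ac.smooth.apply hY)
  rw [← hg] at hN
  unfold genNijenhuis at hN ⊢
  simp only [hq.gen₁_minus, Quadruple.minus_neg] at hN
  simp only [hq.gen₂_minus]
  rw [courant_neg_left hKX hKY.neg, courant_neg_right hKX hKY, neg_neg, courant_neg_left hKX hY',
    courant_neg_right hX' hKY, ← neg_add, gen_map_neg] at hN
  set K := minusConj Ω J with hK
  set r : GenT E x := courant (fun y ↦ (tamedQuadruple Ω J).minus y (K y (X y)))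
      (fun y ↦ (tamedQuadruple Ω J).minus y (Y y)) x +
    courant (fun y ↦ (tamedQuadruple Ω J).minus y (X y))
      (fun y ↦ (tamedQuadruple Ω J).minus y (K y (Y y))) x with hr
  set p : GenT E x := courant (fun y ↦ (tamedQuadruple Ω J).minus y (X y))
      (fun y ↦ (tamedQuadruple Ω J).minus y (Y y)) x -
    courant (fun y ↦ (tamedQuadruple Ω J).minus y (K y (X y)))
      (fun y ↦ (tamedQuadruple Ω J).minus y (K y (Y y))) x with hp
  change p + -(tamedQuadruple Ω J).gen₁ x r = 0 at hN
  change p + (tamedQuadruple Ω J).gen₂ x r = 0 ↔ _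
  have hnij : nijenhuis K X Y x = p.1 + K x r.1 := by
    have h1 : K x r.1 = K x (VectorField.mlieBracket 𝓘(ℝ, E) (fun y ↦ K y (X y)) Y x) +
        K x (VectorField.mlieBracket 𝓘(ℝ, E) X (fun y ↦ K y (Y y)) x) := map_add (K x) _ _
    rw [h1, ← add_assoc]
    rfl
  have hpr : p.1 = (Ω x).inverse r.2 := by
    have h1 := congrArg Prod.fst hN
    rw [hg, hΩ.genOmega_apply'] at h1
    exact eq_of_sub_eq_zero ((sub_eq_add_neg _ _).trans h1)
  rw [hnij, hpr]
  constructor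
  · intro h
    have h1 : r = (tamedQuadruple Ω J).minus x r.1 :=
      hq.eq_minus (add_left_cancel (h.trans hN.symm))
    rw [tamedQuadruple_minus] at h1
    have h2 : r.2 = Ω x (-K x r.1) := (congrArg Prod.snd h1).trans ((Ω x).map_neg _).symm
    rw [h2, inverse_tc_apply (hΩ.isInvertible x), neg_add_cancel]
  · intro h
    have h1 : K x r.1 = -(Ω x).inverse r.2 := eq_neg_of_add_eq_zero_right h
    have h2 : r = (tamedQuadruple Ω J).minus x r.1 := by
      rw [tamedQuadruple_minus, ← hK, h1, (Ω x).map_neg, apply_inverse_tc (hΩ.isInvertible x),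
        neg_neg]
    have h3 : (tamedQuadruple Ω J).gen₂ x r = -(tamedQuadruple Ω J).gen₁ x r := by
      rw [h2, hq.gen₂_minus, hq.gen₁_minus, Quadruple.minus_neg, neg_neg]
    rw [h3, hN]

/-- Integrability of the generalized Kähler structure of a tamed almost complex structure. -/
theorem IsSymplectic.integrableGK_iff :
    IntegrableGK (genOmega Ω) (tamedQuadruple Ω J).gen₂ ↔
      IntegrableAC J ∧ IntegrableAC (minusConj Ω J) := by
  have hq := hΩ.tamedQuadruple_isAlmostBihermitian hJ ht
  have h2 := hq.isAlmostGC_gen₂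
  have h1 : IntegrableGC (genOmega Ω) :=
    (integrableGC_iff hΩ.isAlmostGC).2 fun _ _ ha hb x ↦ hΩ.genNijenhuis_eq_zero ha hb x
  rw [IntegrableGK, and_iff_right h1, integrableGC_iff h2]
  constructor
  · intro h
    exact ⟨fun X Y hX hY x ↦ (hΩ.genNijenhuis_plus hJ ht hX hY x).1
        (h _ _ (hq.smoothGen_plus hX) (hq.smoothGen_plus hY) x),
      fun X Y hX hY x ↦ (hΩ.genNijenhuis_minus hJ ht hX hY x).1
        (h _ _ (hq.smoothGen_minus hX) (hq.smoothGen_minus hY) x)⟩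
  · rintro ⟨hp, hm⟩ a b ha hb x
    exact hq.genNijenhuis_eq_zero h2
      (fun X Y hX hY x ↦ (hΩ.genNijenhuis_plus hJ ht hX hY x).2 (hp X Y hX hY x))
      (fun X Y hX hY x ↦ (hΩ.genNijenhuis_minus hJ ht hX hY x).2 (hm X Y hX hY x)) ha hb x

end TamedIntegrability

/-! ### Exchange of the pair, the bijection and uniqueness of the quadruple. -/

section Swap

variable {E : Type*} [NormedAddCommGroup E] [NormedSpace ℝ E]
  {M : Type*} [TopologicalSpace M] [ChartedSpace E M] [IsManifold 𝓘(ℝ, E) ∞ M]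

theorem IsAlmostGK.swap {𝒥₁ 𝒥₂ : ∀ x : M, GenT E x →L[ℝ] GenT E x} (h : IsAlmostGK 𝒥₁ 𝒥₂) :
    IsAlmostGK 𝒥₂ 𝒥₁ where
  fst := h.snd
  snd := h.fst
  comm x u := (h.comm x u).symm
  symm x u v := by
    rw [← h.comm, ← h.comm]
    exact h.symm x u v
  pos x u hu := by
    rw [← h.comm]
    exact h.pos x u hu

end Swap

/-- The almost generalized Kähler structure `(𝒥_Ω, 𝒥(J))` of a tamed almost complex structure. -/
def tamedEquiv {E : Type*} [NormedAddCommGroup E] [NormedSpace ℝ E] [FiniteDimensional ℝ E]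
    {M : Type*} [TopologicalSpace M] [ChartedSpace E M] [IsManifold 𝓘(ℝ, E) ∞ M]
    {Ω : ∀ x : M, TS E x →L[ℝ] CoT E x} (hΩ : IsSymplectic Ω) :
    {J : ∀ x : M, TS E x →L[ℝ] TS E x // IsAlmostComplex J ∧ Tames Ω J} ≃
      {𝒥 : ∀ x : M, GenT E x →L[ℝ] GenT E x // IsAlmostGK (genOmega Ω) 𝒥} :=
  Equiv.ofBijective
    (fun J ↦ ⟨(tamedQuadruple Ω J.1).gen₂, by
      have h := (hΩ.tamedQuadruple_isAlmostBihermitian J.2.1 J.2.2).isAlmostGK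
      rwa [hΩ.gen₁_tamedQuadruple J.2.1 J.2.2] at h⟩)
    ⟨fun J K h ↦ Subtype.ext (hΩ.gen₂_tamedQuadruple_injective J.2.1 J.2.2 K.2.1 K.2.2
      (congrArg Subtype.val h)), fun 𝒥 ↦ by
      obtain ⟨J, hJ, ht, h⟩ := hΩ.exists_tamed 𝒥.2
      exact ⟨⟨J, hJ, ht⟩, Subtype.ext h⟩⟩

/-- The first structure forces q to be the tamed quadruple of its own J₊; the second identifies that
J₊ with J by injectivity. -/
theorem IsSymplectic.induces_iff {E : Type*} [NormedAddCommGroup E] [NormedSpace ℝ E]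
    [FiniteDimensional ℝ E] {M : Type*} [TopologicalSpace M] [ChartedSpace E M]
    [IsManifold 𝓘(ℝ, E) ∞ M] {Ω : ∀ x : M, TS E x →L[ℝ] CoT E x} (hΩ : IsSymplectic Ω)
    {J : ∀ x : M, TS E x →L[ℝ] TS E x} (hJ : IsAlmostComplex J) (ht : Tames Ω J)
    (q : Quadruple E M) :
    q.Induces (genOmega Ω) (tamedQuadruple Ω J).gen₂ ↔ q = tamedQuadruple Ω J := by
  constructor
  · rintro ⟨hq, h₁, h₂⟩
    obtain ⟨ht', hq'⟩ := hΩ.eq_tamedQuadruple hq h₁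
    rw [hq'] at h₂
    have h := hΩ.gen₂_tamedQuadruple_injective hq.Jp_ac ht' hJ ht h₂
    rw [hq', h]
  · rintro rfl
    exact ⟨hΩ.tamedQuadruple_isAlmostBihermitian hJ ht, hΩ.gen₁_tamedQuadruple hJ ht, rfl⟩

end GenKahler

end

open GenKahler in
theorem proposition2p1
    {E : Type*} [NormedAddCommGroup E] [NormedSpace ℝ E] [FiniteDimensional ℝ E]
    {M : Type*} [TopologicalSpace M] [T2Space M] [SecondCountableTopology M]
    [ChartedSpace E M] [IsManifold 𝓘(ℝ, E) ∞ M]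
    (Ω : ∀ x : M, TS E x →L[ℝ] CoT E x) (hΩ : IsSymplectic Ω) :
    (∃ Φ : {J : ∀ x : M, TS E x →L[ℝ] TS E x // IsAlmostComplex J ∧ Tames Ω J} ≃
          {𝒥 : ∀ x : M, GenT E x →L[ℝ] GenT E x // IsAlmostGK (genOmega Ω) 𝒥},
        ∀ J,
          (∀ q : Quadruple E M,
            q.Induces (genOmega Ω) (Φ J).1 ↔ q = tamedQuadruple Ω J.1) ∧
          (IntegrableGK (genOmega Ω) (Φ J).1 ↔
            IntegrableAC J.1 ∧ IntegrableAC (minusConj Ω J.1))) ∧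
      ∀ 𝒥 : ∀ x : M, GenT E x →L[ℝ] GenT E x,
        (IsAlmostGK 𝒥 (genOmega Ω) ↔ IsAlmostGK (genOmega Ω) 𝒥) ∧
        (IntegrableGK 𝒥 (genOmega Ω) ↔ IntegrableGK (genOmega Ω) 𝒥) :=
  ⟨⟨tamedEquiv hΩ, fun J ↦ ⟨hΩ.induces_iff J.2.1 J.2.2, hΩ.integrableGK_iff J.2.1 J.2.2⟩⟩,
    fun _ ↦ ⟨⟨IsAlmostGK.swap, IsAlmostGK.swap⟩, and_comm⟩⟩
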